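/- Write $\widehat{\mathbb C}=\mathbb C\cup\{\infty\}$, and let $S'$ denote the complement of $S$ in $\widehat{\mathbb C}$. A function $h$ is analytic at $\infty$ if $w\mapsto h(w^{-1})$ is analytic at $0$. Let $R>1$, and let $B_R=\{\tfrac12(\zeta+\zeta^{-1}) : 1\le|\zeta|<R\}$ be the open interior of the Bernstein ellipse with parameter $R$. Let $E=[-1,1]$, let $D$ be a compact metric space, and let $F\subset\widehat{\mathbb C}$ be a closed set with $F\cap B_R=\emptyset$. Let $\lambda,\mu$ be finite Borel measures on $D$ and $E$, and let $\nu$ be a Borel measure on $F$. Let $K\in C(D\times[-1,1])$ be a complex-valued kernel which extends to a function $K\in C(D\times F')$ such that $K(x,\cdot)$ is analytic on $F'$ for every $x\in D$ (in particular, on $B_R$). A kernel $L\in C(D\times[-1,1])$ defines the operator $\mathcal L:L^2_\mu(-1,1)\to L^2_\lambda(D)$, $\mathcal L[g](x)=\int_{-1}^1 L(x,y)g(y)\,\mathrm d\mu(y)$, and its rank is the dimension of the range of $\mathcal L$. The Cauchy transform is $\mathcal C[g](z)=\int_{-1}^1\frac{g(y)}{y-z}\,\mathrm d\mu(y)$ for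 $z\in F$ (with value $0$ at $z=\infty$). Let $H(F)$ be the space of functions $h$ that are analytic on some open set $U\supset F$ of $\widehat{\mathbb C}$, with $h(\infty)=0$ if $\infty\in F$. For $1\le p\le\infty$ let $H^p_\nu(F)$ be the closure in $L^p_\nu(F)$ of $H(F)\cap L^p_\nu(F)$, and let $\mathcal K':H^p_\nu(F)\to L^2_\lambda(D)$ be the continuous extension, if it exists, of $$\mathcal K'[h](x)=\frac1{2\pi\mathrm i}\int_\Gamma K(x,\xi)h(\xi)\,\mathrm d\xi,\qquad h\in H(F)\cap L^p_\nu(F),$$ where $U$ is taken disjoint from $[-1,1]$ and with $\infty\notin U$ unless $\infty\in F$, and $\Gamma\subset U\setminus F$ is any finite sum of oriented rectifiable Jordan curves with $\mathrm{Ind}_\Gamma(F)-\mathrm{Ind}_\Gamma(U')=1$ (and $\mathrm{Ind}_\Gamma(\infty)=0$). If $\mathcal C$ does not map $L^2_\mu(-1,1)$ boundedly to $L^p_\nu(F)$, or the extension $\mathcal K'$ does not exist, the corresponding norm is $\infty$. Then for every $n=1,2,\dots$ there is a kernel $K_n\in C(D\times[-1,1])$ of rank at most $n$ such that, for every $p\in[1,\infty]$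 for which the two norms on the right are finite, $$\|\mathcal K-\mathcal K_n\|_{L^2_\mu(-1,1)\to L^2_\lambda(D)}\le\frac{2R^{-n}}{1-R^{-2n}}\,\|\mathcal C\|_{L^2_\mu(-1,1)\to L^p_\nu(F)}\,\|\mathcal K'\|_{H^p_\nu(F)\to L^2_\lambda(D)}.$$ -/

import Mathlib

open MeasureTheory Set
open scoped ENNReal

noncomputable section

namespace LowRank

/-! ### Integral operators with continuous kernel -/

section KernelOperator

set_option linter.unusedSectionVars false

variable {D E : Type*} [TopologicalSpace D] [CompactSpace D]
  [TopologicalSpace E] [CompactSpace E] [SecondCountableTopology E]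
  [MeasurableSpace E] [BorelSpace E]

theorem integral_kernel_eq_inner (μ : Measure E) [IsFiniteMeasure μ] (K : C(D × E, ℂ))
    (g : Lp ℂ 2 μ) (x : D) :
    ∫ y, K (x, y) * g y ∂μ = inner ℂ (ContinuousMap.toLp 2 μ ℂ (star (K.curry x))) g := by
  rw [L2.inner_def]
  refine integral_congr_ae ?_
  filter_upwards [ContinuousMap.coeFn_toLp (p := 2) (𝕜 := ℂ) μ (star (K.curry x))] with y hy
  rw [hy]
  simp [mul_comm]

theorem continuous_integral_kernel (μ : Measure E) [IsFiniteMeasure μ] (K : C(D × E, ℂ))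
    (g : Lp ℂ 2 μ) : Continuous fun x : D => ∫ y, K (x, y) * g y ∂μ := by
  simp_rw [integral_kernel_eq_inner]
  have h : Continuous fun x : D => star (K.curry x) := K.curry.continuous.star
  exact ((ContinuousMap.toLp 2 μ ℂ).continuous.comp h).inner continuous_const

/-- The map `g ↦ (x ↦ ∫ K(x, y) g(y) dμ(y))`, as a bounded operator from `L²(μ)` to `C(D)`. -/
def kernelOpC (μ : Measure E) [IsFiniteMeasure μ] (K : C(D × E, ℂ)) :
    Lp ℂ 2 μ →L[ℂ] C(D, ℂ) :=
  LinearMap.mkContinuous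
    { toFun := fun g => ⟨fun x => ∫ y, K (x, y) * g y ∂μ, continuous_integral_kernel μ K g⟩
      map_add' := by
        intro g₁ g₂
        ext x
        change ∫ y, K (x, y) * (g₁ + g₂ : Lp ℂ 2 μ) y ∂μ =
          ∫ y, K (x, y) * g₁ y ∂μ + ∫ y, K (x, y) * g₂ y ∂μ
        simp only [integral_kernel_eq_inner, inner_add_right]
      map_smul' := by
        intro c g
        ext x
        change ∫ y, K (x, y) * (c • g : Lp ℂ 2 μ) y ∂μ = c * ∫ y, K (x, y) * g y ∂μ
        simp only [integral_kernel_eq_inner, inner_smul_right] }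
    (‖(ContinuousMap.toLp 2 μ ℂ : C(E, ℂ) →L[ℂ] Lp ℂ 2 μ)‖ * ‖K.curry‖) (by
      intro g
      rw [ContinuousMap.norm_le _ (by positivity)]
      intro x
      change ‖∫ y, K (x, y) * g y ∂μ‖ ≤ _
      rw [integral_kernel_eq_inner]
      refine (norm_inner_le_norm _ _).trans ?_
      gcongr
      refine (ContinuousLinearMap.le_opNorm _ _).trans ?_
      rw [norm_star]
      gcongr
      exact K.curry.norm_coe_le_norm x)

variable [SecondCountableTopology D] [MeasurableSpace D] [BorelSpace D]

/-- The operator `𝒦 : L²(μ) → L²(λ)`, `𝒦[g](x) = ∫ K(x, y) g(y) dμ(y)`, of a continuous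
kernel `K`. -/
def kernelOp (lam : Measure D) [IsFiniteMeasure lam] (μ : Measure E) [IsFiniteMeasure μ]
    (K : C(D × E, ℂ)) : Lp ℂ 2 μ →L[ℂ] Lp ℂ 2 lam :=
  (ContinuousMap.toLp 2 lam ℂ).comp (kernelOpC μ K)

end KernelOperator

/-! ### The Riemann sphere `OnePoint ℂ` and analytic functions on it -/

instance instMeasurableSpaceSphere : MeasurableSpace (OnePoint ℂ) := borel _

instance instBorelSpaceSphere : BorelSpace (OnePoint ℂ) := ⟨rfl⟩

/-- `w ↦ w⁻¹` as a map into the sphere, with `0 ↦ ∞`. -/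
def invChart (w : ℂ) : OnePoint ℂ := if w = 0 then OnePoint.infty else ((w⁻¹ : ℂ) : OnePoint ℂ)

/-- `h` is analytic at every point of `V`; at `∞` this means that `w ↦ h(w⁻¹)` is analytic
at `0`. -/
def AnalyticOnSphere (h : OnePoint ℂ → ℂ) (V : Set (OnePoint ℂ)) : Prop :=
  (∀ z : ℂ, (z : OnePoint ℂ) ∈ V → AnalyticAt ℂ (fun w : ℂ => h w) z) ∧
    (OnePoint.infty ∈ V → AnalyticAt ℂ (fun w : ℂ => h (invChart w)) 0)

/-- `h` represents an element of `H(F)` on the open neighbourhood `U` of `F`: it is analytic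
on `U`, and vanishes at `∞` if `∞ ∈ F`. -/
structure RepresentsOn (F U : Set (OnePoint ℂ)) (h : OnePoint ℂ → ℂ) : Prop where
  isOpen : IsOpen U
  subset : F ⊆ U
  analytic : AnalyticOnSphere h U
  vanish : OnePoint.infty ∈ F → h OnePoint.infty = 0

/-- The open interior of the Bernstein ellipse with parameter `R`, i.e. of the image of the
circle `|ζ| = R` under `ζ ↦ (ζ + ζ⁻¹) / 2`. -/
def bernsteinInterior (R : ℝ) : Set ℂ :=
  {z | ∃ ζ : ℂ, 1 ≤ ‖ζ‖ ∧ ‖ζ‖ < R ∧ z = (ζ + ζ⁻¹) / 2}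

/-- The interval `[-1, 1]` in the sphere. -/
def segmentSphere : Set (OnePoint ℂ) :=
  range fun y : Icc (-1 : ℝ) 1 => (((y : ℝ) : ℂ) : OnePoint ℂ)

/-! ### Contours -/

/-- A rectifiable oriented Jordan curve, parametrized by a Lipschitz function on `[0, 1]`
(for instance proportionally to arc length). -/
structure RectJordanCurve where
  toFun : ℝ → ℂ
  lipschitz : ∃ c, LipschitzOnWith c toFun (Icc 0 1)
  closed : toFun 0 = toFun 1
  injOn : InjOn toFun (Ico 0 1)

/-- A finite formal sum of rectifiable Jordan curves. -/
abbrev Contour := List RectJordanCurve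

/-- The union of the curves of a contour. -/
def Contour.trace (Γ : Contour) : Set ℂ := {ξ | ∃ γ ∈ Γ, ξ ∈ γ.toFun '' Icc 0 1}

/-- `∫_Γ f(ξ) dξ`. -/
def Contour.integral (Γ : Contour) (f : ℂ → ℂ) : ℂ :=
  (Γ.map fun γ => ∫ t in (0 : ℝ)..1, f (γ.toFun t) * deriv γ.toFun t).sum

/-- The winding number of `Γ` about a point of the sphere off `Γ`; it is `0` about `∞`. -/
def Contour.index (Γ : Contour) (z : OnePoint ℂ) : ℂ :=
  z.elim 0 fun w => (2 * Real.pi * Complex.I)⁻¹ * Γ.integral fun ξ => (ξ - w)⁻¹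

/-- `Γ` lies in `U \ F` and `Ind_Γ(F) - Ind_Γ(U') = 1`, where `U'` is the complement of `U` in
the sphere. -/
structure Contour.Separates (Γ : Contour) (F U : Set (OnePoint ℂ)) : Prop where
  trace_subset : ∀ ξ ∈ Γ.trace, (ξ : OnePoint ℂ) ∈ U \ F
  index_eq : ∃ k : ℤ, (∀ z ∈ F, Γ.index z = k + 1) ∧ ∀ w ∈ Uᶜ, Γ.index w = k

/-! ### The spaces `H^p_ν(F)` and the operators `𝒞` and `𝒦'` -/

section Operators

variable {F : Set (OnePoint ℂ)}

/-- The classes in `L^p_ν(F)` of the functions in `H(F)`. -/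
def analyticClasses (p : ℝ≥0∞) (ν : Measure F) : Submodule ℂ (Lp ℂ p ν) where
  carrier := {f | ∃ U h, RepresentsOn F U h ∧ f =ᵐ[ν] fun z : F => h z}
  zero_mem' := ⟨univ, 0, ⟨isOpen_univ, subset_univ _,
    ⟨fun _ _ => analyticAt_const, fun _ => analyticAt_const⟩, fun _ => rfl⟩, Lp.coeFn_zero ..⟩
  add_mem' := by
    rintro f₁ f₂ ⟨U₁, h₁, H₁, e₁⟩ ⟨U₂, h₂, H₂, e₂⟩
    refine ⟨U₁ ∩ U₂, h₁ + h₂, ⟨H₁.isOpen.inter H₂.isOpen, subset_inter H₁.subset H₂.subset,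
      ⟨fun z hz => (H₁.analytic.1 z hz.1).add (H₂.analytic.1 z hz.2),
        fun hz => (H₁.analytic.2 hz.1).add (H₂.analytic.2 hz.2)⟩,
      fun hF => by simp [H₁.vanish hF, H₂.vanish hF]⟩, ?_⟩
    filter_upwards [Lp.coeFn_add f₁ f₂, e₁, e₂] with z hz h1 h2
    rw [hz, Pi.add_apply, h1, h2, Pi.add_apply]
  smul_mem' := by
    rintro c f ⟨U, h, H, e⟩
    refine ⟨U, c • h, ⟨H.isOpen, H.subset,
      ⟨fun z hz => analyticAt_const.mul (H.analytic.1 z hz),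
        fun hz => analyticAt_const.mul (H.analytic.2 hz)⟩,
      fun hF => by simp [H.vanish hF]⟩, ?_⟩
    filter_upwards [Lp.coeFn_smul c f, e] with z hz h1
    rw [hz, Pi.smul_apply, h1, Pi.smul_apply]

/-- The Bergman space `H^p_ν(F)`: the closure in `L^p_ν(F)` of the functions analytic on `F`. -/
def bergman (p : ℝ≥0∞) [Fact (1 ≤ p)] (ν : Measure F) : Submodule ℂ (Lp ℂ p ν) :=
  (analyticClasses p ν).topologicalClosure

/-- The Cauchy transform `𝒞[g](z) = ∫ g(y) / (y - z) dμ(y)`, with value `0` at `z = ∞`. -/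
def cauchyTransform (μ : Measure (Icc (-1 : ℝ) 1)) (g : Icc (-1 : ℝ) 1 → ℂ)
    (z : OnePoint ℂ) : ℂ :=
  z.elim 0 fun w => ∫ y, g y / (((y : ℝ) : ℂ) - w) ∂μ

/-- The bounded operator `T` is the Cauchy transform from `L²_μ(-1, 1)` to `L^p_ν(F)`. -/
def IsCauchyOp (μ : Measure (Icc (-1 : ℝ) 1)) (p : ℝ≥0∞) [Fact (1 ≤ p)] (ν : Measure F)
    (T : Lp ℂ 2 μ →L[ℂ] Lp ℂ p ν) : Prop :=
  ∀ g : Lp ℂ 2 μ, T g =ᵐ[ν] fun z : F => cauchyTransform μ g z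

/-- The norm `‖𝒞‖` from `L²_μ(-1, 1)` to `L^p_ν(F)`; it is `∞` if `𝒞` is not a bounded operator
between these spaces. (There is at most one `T` as below.) -/
def cauchyNorm (μ : Measure (Icc (-1 : ℝ) 1)) (p : ℝ≥0∞) [Fact (1 ≤ p)] (ν : Measure F) :
    ℝ≥0∞ :=
  ⨅ (T : Lp ℂ 2 μ →L[ℂ] Lp ℂ p ν) (_ : IsCauchyOp μ p ν T), ‖T‖ₑ

variable {D : Type*} [MeasurableSpace D]

/-- The bounded operator `T` from `H^p_ν(F)` to `L²_λ(D)` is `𝒦'`: for every `h ∈ H(F)` with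
finite `L^p_ν(F)` norm, `T[h](x) = (2πi)⁻¹ ∫_Γ K(x, ξ) h(ξ) dξ`. Here `Γ ⊆ U \ F` is any contour
with `Ind_Γ(F) - Ind_Γ(U') = 1`, where `h` is analytic on the open set `U ⊇ F`, and `U` is taken
so small that it does not meet `[-1, 1]`, and does not contain `∞` unless `F` does. -/
def IsDualOp (K : D → OnePoint ℂ → ℂ) (lam : Measure D) (p : ℝ≥0∞) [Fact (1 ≤ p)]
    (ν : Measure F) (T : bergman p ν →L[ℂ] Lp ℂ 2 lam) : Prop :=
  ∀ (U : Set (OnePoint ℂ)) (h : OnePoint ℂ → ℂ) (Γ : Contour) (f : bergman p ν),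
    RepresentsOn F U h → Disjoint U segmentSphere → (OnePoint.infty ∈ U → OnePoint.infty ∈ F) →
    Γ.Separates F U →
    (f : Lp ℂ p ν) =ᵐ[ν] (fun z : F => h z) →
    T f =ᵐ[lam] fun x => (2 * Real.pi * Complex.I)⁻¹ * Γ.integral fun ξ => K x ξ * h ξ

/-- The norm `‖𝒦'‖` from `H^p_ν(F)` to `L²_λ(D)`; it is `∞` if `𝒦'` does not define a bounded
operator between these spaces. (There is at most one `T` as below.) -/
def dualNorm (K : D → OnePoint ℂ → ℂ) (lam : Measure D) (p : ℝ≥0∞) [Fact (1 ≤ p)]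
    (ν : Measure F) : ℝ≥0∞ :=
  ⨅ (T : bergman p ν →L[ℂ] Lp ℂ 2 lam) (_ : IsDualOp K lam p ν T), ‖T‖ₑ

end Operators

end LowRank

end

noncomputable section

namespace LowRank

open Complex Metric Filter Topology Polynomial Bornology

/-! ### The Joukowski map and Chebyshev polynomials -/

/-! The approximating kernel interpolates `K(x, ·)` at the `n` zeros of the Chebyshev polynomial
`T_n`; its operator has range in the span of the slices of `K` at the nodes, hence rank at most `n`,
and it does not depend on `p`.

Everything rests on Hermite's remainder formula. For a curve around `[-1, 1]` inside the Bernstein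
ellipse, Cauchy's formula together with `inv_sub_sum_chebyshevBasis` gives, for a positively
oriented contour, `K(x, y) - K_n(x, y) = (2πi)⁻¹ ∫ K(x, ξ) T_n(y) / (T_n(ξ) (ξ - y)) dξ`.
Integrating against `g(y) dμ(y)` and exchanging the integrals turns this into the factorization `(𝒦
- 𝒦_n)[g] = 𝒦'[T_n⁻¹ · 𝒞[T_n g]]`. The function `T_n⁻¹ · 𝒞[T_n g]` is analytic off `[-1, 1]` and
vanishes at `∞`, so it is admissible for `𝒦'`.

Multiplication by `T_n` has norm at most `1` on `L²_μ`, since `|T_n| ≤ 1` on `[-1, 1]`.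
Multiplication by `T_n⁻¹` on `F` costs at most `2 / (R^n - R^(-n))`, because `T_n((ζ + ζ⁻¹)/2) =
(ζ^n + ζ^(-n))/2` and points outside the ellipse have a preimage with `|ζ| ≥ R`
(`le_norm_eval_chebyshevT`). The product of the four norms is the bound.

The contour is the Joukowski image of a circle `|ζ| = s` with `R⁻¹ < s < 1`, an ellipse run
clockwise. Pulling back to the annulus `s ≤ |ζ| ≤ 1` reduces Cauchy's theorem on ellipses to circle
integrals. If `∞ ∉ F`, a large circle must be added to meet the index condition; it contributes
nothing because the integrand is `o(1/ξ)` (`exists_separating_contour`). -/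

/-- The Joukowski map. -/
def joukowski (ζ : ℂ) : ℂ := (ζ + ζ⁻¹) / 2

theorem joukowski_inv (ζ : ℂ) : joukowski ζ⁻¹ = joukowski ζ := by
  simp [joukowski, add_comm]

theorem joukowski_eq_iff {ζ η : ℂ} (hζ : ζ ≠ 0) (hη : η ≠ 0) :
    joukowski ζ = joukowski η ↔ ζ = η ∨ ζ * η = 1 := by
  have key : joukowski ζ - joukowski η = (ζ - η) * (ζ * η - 1) / (2 * ζ * η) := by
    unfold joukowski
    field_simp
    ring
  rw [← sub_eq_zero, key, div_eq_zero_iff, mul_eq_zero, sub_eq_zero, sub_eq_zero]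
  simp [hζ, hη]

/-- The preimages of `z` are the roots `z ± √(z² - 1)` of a quadratic with product `1`, so one of
them lies outside the open unit disc. -/
theorem exists_joukowski_eq (z : ℂ) : ∃ ζ : ℂ, 1 ≤ ‖ζ‖ ∧ joukowski ζ = z := by
  obtain ⟨s, hs⟩ := IsAlgClosed.exists_pow_nat_eq (z ^ 2 - 1) (n := 2) (by norm_num)
  have hmul : (z + s) * (z - s) = 1 := by linear_combination -hs
  have hne : z + s ≠ 0 := left_ne_zero_of_mul_eq_one hmul
  have hinv : (z + s)⁻¹ = z - s := inv_eq_of_mul_eq_one_right hmul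
  have hJ : joukowski (z + s) = z := by
    rw [joukowski, hinv]
    ring
  rcases le_total 1 ‖z + s‖ with h | h
  · exact ⟨_, h, hJ⟩
  · refine ⟨(z + s)⁻¹, ?_, by rw [joukowski_inv, hJ]⟩
    rw [norm_inv]
    exact (one_le_inv₀ (norm_pos_iff.2 hne)).2 h

theorem exists_norm_eq_one_joukowski_eq {y : ℝ} (hy : y ∈ Icc (-1 : ℝ) 1) :
    ∃ η : ℂ, ‖η‖ = 1 ∧ joukowski η = y := by
  refine ⟨exp (Real.arccos y * I), norm_exp_ofReal_mul_I _, ?_⟩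
  rw [joukowski, ← Complex.exp_neg, ← neg_mul, ← Complex.cos, ← Complex.ofReal_cos,
    Real.cos_arccos hy.1 hy.2]

theorem norm_eq_one_of_joukowski_eq {ζ : ℂ} (hζ : ζ ≠ 0) {y : ℝ} (hy : y ∈ Icc (-1 : ℝ) 1)
    (h : joukowski ζ = y) : ‖ζ‖ = 1 := by
  obtain ⟨η, hη, hJ⟩ := exists_norm_eq_one_joukowski_eq hy
  have hη0 : η ≠ 0 := norm_ne_zero_iff.1 (by simp [hη])
  rcases (joukowski_eq_iff hζ hη0).1 (h.trans hJ.symm) with h | h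
  · rw [h, hη]
  · simpa [hη] using congrArg norm h

theorem joukowski_eq_re {ζ : ℂ} (hζ : ‖ζ‖ = 1) : joukowski ζ = ζ.re := by
  have : ζ⁻¹ = (starRingEnd ℂ) ζ := by
    rw [Complex.inv_def, Complex.normSq_eq_norm_sq, hζ]
    simp
  rw [joukowski, this, Complex.add_conj]
  push_cast
  ring

theorem joukowski_mem_bernsteinInterior {R : ℝ} (hR : 0 < R) {ζ : ℂ} (h₁ : R⁻¹ < ‖ζ‖)
    (h₂ : ‖ζ‖ < R) : joukowski ζ ∈ bernsteinInterior R := by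
  have hpos : 0 < ‖ζ‖ := (inv_pos.2 hR).trans h₁
  rcases le_total 1 ‖ζ‖ with h | h
  · exact ⟨ζ, h, h₂, rfl⟩
  · refine ⟨ζ⁻¹, ?_, ?_, (joukowski_inv ζ).symm⟩
    · rw [norm_inv]
      exact (one_le_inv₀ hpos).2 h
    · rw [norm_inv]
      exact inv_lt_of_inv_lt₀ hR h₁

theorem ofReal_mem_bernsteinInterior {R : ℝ} (hR : 1 < R) {y : ℝ} (hy : y ∈ Icc (-1 : ℝ) 1) :
    (y : ℂ) ∈ bernsteinInterior R := by
  obtain ⟨η, hη, hJ⟩ := exists_norm_eq_one_joukowski_eq hy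
  exact ⟨η, hη.ge, hη.trans_lt hR, hJ.symm⟩

theorem eval_chebyshevT_joukowski (n : ℕ) {ζ : ℂ} (hζ : ζ ≠ 0) :
    (Chebyshev.T ℂ n).eval (joukowski ζ) = (ζ ^ n + (ζ ^ n)⁻¹) / 2 := by
  obtain ⟨θ, rfl⟩ : ∃ θ, exp θ = ζ := ⟨log ζ, exp_log hζ⟩
  have h := Chebyshev.T_complex_cosh θ n
  rw [Complex.cosh, Complex.cosh] at h
  rw [joukowski, ← Complex.exp_neg, h, ← Complex.exp_nat_mul, ← Complex.exp_neg]
  simp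

theorem le_norm_eval_chebyshevT_joukowski (n : ℕ) {r : ℝ} (hr : 1 ≤ r) {ζ : ℂ} (hζ : r ≤ ‖ζ‖) :
    (r ^ n - (r ^ n)⁻¹) / 2 ≤ ‖(Chebyshev.T ℂ n).eval (joukowski ζ)‖ := by
  have h0 : ζ ≠ 0 := norm_pos_iff.1 (by linarith)
  rw [eval_chebyshevT_joukowski n h0, norm_div, Complex.norm_ofNat]
  have h1 : ‖ζ‖ ^ n - (‖ζ‖ ^ n)⁻¹ ≤ ‖ζ ^ n + (ζ ^ n)⁻¹‖ := by
    have := norm_sub_norm_le (ζ ^ n) (-(ζ ^ n)⁻¹)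
    simpa using this
  have h2 : r ^ n ≤ ‖ζ‖ ^ n := by gcongr
  have h3 : (‖ζ‖ ^ n)⁻¹ ≤ (r ^ n)⁻¹ := by gcongr
  linarith

theorem le_norm_eval_chebyshevT (n : ℕ) {R : ℝ} (hR : 1 < R) {z : ℂ}
    (hz : z ∉ bernsteinInterior R) :
    (R ^ n - (R ^ n)⁻¹) / 2 ≤ ‖(Chebyshev.T ℂ n).eval z‖ := by
  obtain ⟨ζ, hζ, rfl⟩ := exists_joukowski_eq z
  refine le_norm_eval_chebyshevT_joukowski n hR.le (le_of_not_gt fun h => hz ⟨ζ, hζ, h, rfl⟩)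

theorem pow_sub_inv_pow_pos {r : ℝ} (hr : 1 < r) {n : ℕ} (hn : n ≠ 0) :
    0 < (r ^ n - (r ^ n)⁻¹) / 2 := by
  have h := one_lt_pow₀ hr hn
  have := inv_lt_one_of_one_lt₀ h
  linarith

/-- Write `z = joukowski ζ` with `|ζ| ≥ 1`. If `|ζ| = 1`, then `z` is the real part of `ζ`, in `[-1,
1]`; otherwise the lower bound with `r = |ζ|` is strictly positive. -/
theorem eval_chebyshevT_ne_zero {n : ℕ} (hn : n ≠ 0) {z : ℂ}
    (hz : ∀ y ∈ Icc (-1 : ℝ) 1, z ≠ (y : ℂ)) : (Chebyshev.T ℂ n).eval z ≠ 0 := by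
  obtain ⟨ζ, hζ, rfl⟩ := exists_joukowski_eq z
  rcases hζ.eq_or_lt with h | h
  · exact absurd (joukowski_eq_re h.symm) (hz _ (abs_le.1 (h ▸ Complex.abs_re_le_norm ζ)))
  · exact norm_pos_iff.1 ((pow_sub_inv_pow_pos h hn).trans_le
      (le_norm_eval_chebyshevT_joukowski n hζ le_rfl))

/-! ### Chebyshev nodes and interpolation of the Cauchy kernel -/

/-- The zeros of the Chebyshev polynomial of degree `n`. -/
def chebyshevNode (n : ℕ) (j : Fin n) : Icc (-1 : ℝ) 1 :=
  ⟨Real.cos ((2 * j + 1) * Real.pi / (2 * n)), Real.neg_one_le_cos _, Real.cos_le_one _⟩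

theorem chebyshevNode_injective (n : ℕ) : Function.Injective (chebyshevNode n) := by
  have hmem : ∀ j : Fin n, (2 * (j : ℝ) + 1) * Real.pi / (2 * n) ∈ Icc 0 Real.pi := by
    intro j
    have hn : (0 : ℝ) < n := Nat.cast_pos.2 (Fin.pos j)
    have hj : (j : ℝ) + 1 ≤ n := by exact_mod_cast j.2
    refine ⟨by positivity, ?_⟩
    rw [div_le_iff₀ (by positivity)]
    nlinarith [Real.pi_pos]
  intro i j hij
  have hn : (0 : ℝ) < n := Nat.cast_pos.2 (Fin.pos j)
  have h := Real.injOn_cos (hmem i) (hmem j) (congrArg Subtype.val hij)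
  field_simp at h
  exact Fin.ext (by exact_mod_cast (by linarith : (i : ℝ) = j))

theorem eval_chebyshevT_node (n : ℕ) (j : Fin n) :
    (Chebyshev.T ℂ n).eval (((chebyshevNode n j : ℝ)) : ℂ) = 0 := by
  have hn : (n : ℝ) ≠ 0 := Nat.cast_ne_zero.2 (Fin.pos j).ne'
  have h : (Chebyshev.T ℝ n).eval (chebyshevNode n j : ℝ) = 0 := by
    rw [chebyshevNode, Chebyshev.T_real_cos, Real.cos_eq_zero_iff]
    exact ⟨j, by push_cast; field_simp⟩
  rw [← Chebyshev.complex_ofReal_eval_T, h, ofReal_zero]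

theorem norm_eval_chebyshevT_le_one (n : ℕ) (y : Icc (-1 : ℝ) 1) :
    ‖(Chebyshev.T ℂ n).eval ((y : ℝ) : ℂ)‖ ≤ 1 := by
  rw [← Chebyshev.complex_ofReal_eval_T, Complex.norm_real]
  exact Chebyshev.abs_eval_T_real_le_one n (abs_le.2 y.2)

/-- The Lagrange basis polynomials at the Chebyshev nodes. -/
def chebyshevBasis (n : ℕ) (j : Fin n) : ℂ[X] :=
  Lagrange.basis Finset.univ (fun i => ((chebyshevNode n i : ℝ) : ℂ)) j

theorem chebyshevNode_ofReal_injective (n : ℕ) :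
    Function.Injective fun i => ((chebyshevNode n i : ℝ) : ℂ) :=
  ofReal_injective.comp (Subtype.val_injective.comp (chebyshevNode_injective n))

/-- The remainder formula for the interpolation of `y ↦ (ξ - y)⁻¹` at the Chebyshev nodes. -/
theorem inv_sub_sum_chebyshevBasis (n : ℕ) {ξ y : ℂ} (hq : (Chebyshev.T ℂ n).eval ξ ≠ 0)
    (hξ : ξ ≠ y) :
    (ξ - y)⁻¹ - ∑ j, (ξ - ((chebyshevNode n j : ℝ) : ℂ))⁻¹ * (chebyshevBasis n j).eval y =
      (Chebyshev.T ℂ n).eval y / ((Chebyshev.T ℂ n).eval ξ * (ξ - y)) := by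
  set v : Fin n → ℂ := fun i => ((chebyshevNode n i : ℝ) : ℂ) with hv
  have hvne : ∀ j, ξ ≠ v j := fun j h => hq (h ▸ eval_chebyshevT_node n j)
  set q := Chebyshev.T ℂ n
  have hvi : InjOn v (Finset.univ : Finset (Fin n)) := (chebyshevNode_ofReal_injective n).injOn
  set L := Lagrange.interpolate Finset.univ v fun j => (ξ - v j)⁻¹ with hL
  have hLe : L.eval y = ∑ j, (ξ - v j)⁻¹ * (chebyshevBasis n j).eval y := by
    simp [hL, Lagrange.interpolate_apply, eval_finsetSum, chebyshevBasis, hv]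
  -- For `n = 0` there are no nodes and `T_0 = 1`, so both sides are `(ξ - y)⁻¹`.
  obtain ⟨m, rfl⟩ | rfl : (∃ m, n = m + 1) ∨ n = 0 := by
    cases n <;> simp
  swap
  · simp [q]
  have hLd : L.natDegree ≤ m := by
    have := Lagrange.degree_interpolate_le (fun j => (ξ - v j)⁻¹) hvi
    rw [Finset.card_univ, Fintype.card_fin, Nat.add_sub_cancel] at this
    exact natDegree_le_of_degree_le this
  have hqd : q.natDegree ≤ m + 1 := by
    rw [show q = Chebyshev.T ℂ ((m + 1 : ℕ) : ℤ) from rfl, Chebyshev.natDegree_T,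
      Int.natAbs_natCast]
  -- This polynomial has degree at most `n = m + 1` and vanishes at the `n` nodes and at `ξ`. These
  -- are `n + 1` distinct points, indexed by `Option`, with `none` standing for `ξ`.
  have hP : (1 - C (q.eval ξ)⁻¹ * q - (C ξ - X) * L : ℂ[X]) = 0 := by
    refine Polynomial.eq_zero_of_natDegree_lt_card_of_eval_eq_zero _
      (f := fun o : Option (Fin (m + 1)) => o.elim ξ v) ?_ ?_ ?_
    · rintro (_ | i) (_ | j) h
      · rfl
      · exact absurd h (hvne j)
      · exact absurd h.symm (hvne i)
      · exact congrArg some (chebyshevNode_ofReal_injective _ h)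
    · rintro (_ | j)
      · simp [hq]
      · have h1 : q.eval (v j) = 0 := eval_chebyshevT_node _ j
        have h2 : L.eval (v j) = (ξ - v j)⁻¹ :=
          Lagrange.eval_interpolate_at_node _ hvi (Finset.mem_univ j)
        simp [h1, h2, sub_ne_zero.2 (hvne j)]
    · have hd : (1 - C (q.eval ξ)⁻¹ * q - (C ξ - X) * L : ℂ[X]).natDegree ≤ m + 1 := by
        have h1 : (C (q.eval ξ)⁻¹ * q).natDegree ≤ m + 1 := (natDegree_C_mul_le _ _).trans hqd
        have h2 : ((C ξ - X) * L).natDegree ≤ m + 1 := by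
          refine natDegree_mul_le.trans ?_
          have : (C ξ - X : ℂ[X]).natDegree ≤ 1 := by compute_degree
          omega
        refine (natDegree_sub_le_of_le (natDegree_sub_le_of_le (m := m + 1) ?_ h1) h2).trans ?_
        · simp
        · simp
      simp only [Fintype.card_option, Fintype.card_fin]
      omega
  have h := congrArg (eval y) hP
  simp only [eval_sub, eval_one, eval_mul, eval_C, eval_X, eval_zero] at h
  rw [← hLe]
  have hs : ξ - y ≠ 0 := sub_ne_zero.2 hξ
  field_simp
  field_simp at h
  linear_combination h

/-! ### Elliptic contours -/

theorem circleMap_two_pi_mul_injOn {s : ℝ} (hs : 0 < s) :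
    InjOn (fun t : ℝ => circleMap 0 s (2 * Real.pi * t)) (Ico 0 1) := by
  intro t ht u hu h
  have hpi := Real.pi_pos
  have := injOn_circleMap_of_abs_sub_le' (c := 0) (R := s) hs.ne' (a := 0) (b := 2 * Real.pi)
    (by simp) (x₁ := 2 * Real.pi * t) ⟨by nlinarith [ht.1], by nlinarith [ht.2]⟩
    (x₂ := 2 * Real.pi * u) ⟨by nlinarith [hu.1], by nlinarith [hu.2]⟩ h
  exact mul_left_cancel₀ (by positivity) this

/-- The image of the circle `|ζ| = s` under `ζ ↦ a ζ + b ζ⁻¹`. -/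
def ellipticCurve (a b : ℂ) (s : ℝ) (hs : 0 < s) (hab : ‖b‖ ≠ ‖a‖ * s ^ 2) : RectJordanCurve where
  toFun t := a * circleMap 0 s (2 * Real.pi * t) + b * (circleMap 0 s (2 * Real.pi * t))⁻¹
  lipschitz := by
    have h1 : ContDiff ℝ 1 fun t : ℝ => circleMap 0 s (2 * Real.pi * t) :=
      (contDiff_circleMap 0 s).comp (contDiff_const.mul contDiff_id)
    have h2 : ContDiff ℝ 1 fun t : ℝ => a * circleMap 0 s (2 * Real.pi * t) +
        b * (circleMap 0 s (2 * Real.pi * t))⁻¹ :=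
      (contDiff_const.mul h1).add (contDiff_const.mul (h1.inv fun t => circleMap_ne_center hs.ne'))
    exact (h2.contDiffOn).exists_lipschitzOnWith one_ne_zero (convex_Icc 0 1) isCompact_Icc
  closed := by
    simp [circleMap]
  injOn := by
    intro t ht u hu h
    refine circleMap_two_pi_mul_injOn hs ht hu ?_
    simp only at h ⊢
    set ζ := circleMap 0 s (2 * Real.pi * t) with hζ
    set η := circleMap 0 s (2 * Real.pi * u) with hη
    have hζ0 : ζ ≠ 0 := circleMap_ne_center hs.ne'
    have hη0 : η ≠ 0 := circleMap_ne_center hs.ne'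
    have hζn : ‖ζ‖ = s := by simp [hζ, abs_of_pos hs]
    have hηn : ‖η‖ = s := by simp [hη, abs_of_pos hs]
    -- A vanishing second factor would force `‖b‖ = ‖a‖ * s ^ 2`, the degenerate case excluded by
    -- `hab`, in which the ellipse collapses to a segment or a point.
    have key : (ζ - η) * (a * (ζ * η) - b) = 0 := by
      field_simp at h
      linear_combination h
    rcases mul_eq_zero.1 key with h | h
    · exact sub_eq_zero.1 h
    · refine absurd ?_ hab
      rw [← sub_eq_zero.1 h, norm_mul, norm_mul, hζn, hηn, sq]

theorem hasDerivAt_ellipticCurve (a b : ℂ) (s : ℝ) (hs : 0 < s) (hab : ‖b‖ ≠ ‖a‖ * s ^ 2)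
    (t : ℝ) :
    HasDerivAt (ellipticCurve a b s hs hab).toFun
      (2 * Real.pi * (deriv (circleMap 0 s) (2 * Real.pi * t) *
        (a - b * (circleMap 0 s (2 * Real.pi * t) ^ 2)⁻¹))) t := by
  have h0 : circleMap 0 s (2 * Real.pi * t) ≠ 0 := circleMap_ne_center hs.ne'
  have h1 : HasDerivAt (fun t : ℝ => circleMap 0 s (2 * Real.pi * t))
      ((2 * Real.pi : ℝ) • (deriv (circleMap 0 s) (2 * Real.pi * t))) t := by
    have := (differentiable_circleMap 0 s (2 * Real.pi * t)).hasDerivAt.scomp t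
      ((hasDerivAt_id t).const_mul (2 * Real.pi))
    simpa only [Function.comp_def, id, mul_one] using this
  refine ((h1.const_mul a).add ((h1.inv h0).const_mul b)).congr_deriv ?_
  rw [real_smul]
  push_cast
  field_simp
  ring

theorem continuous_ellipticCurve (a b : ℂ) (s : ℝ) (hs : 0 < s) (hab : ‖b‖ ≠ ‖a‖ * s ^ 2) :
    Continuous (ellipticCurve a b s hs hab).toFun :=
  continuous_iff_continuousAt.2 fun t => (hasDerivAt_ellipticCurve a b s hs hab t).continuousAt

theorem continuous_deriv_ellipticCurve (a b : ℂ) (s : ℝ) (hs : 0 < s)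
    (hab : ‖b‖ ≠ ‖a‖ * s ^ 2) : Continuous (deriv (ellipticCurve a b s hs hab).toFun) := by
  rw [funext fun t => (hasDerivAt_ellipticCurve a b s hs hab t).deriv]
  have hc : Continuous fun t : ℝ => circleMap 0 s (2 * Real.pi * t) :=
    (continuous_circleMap 0 s).comp (by fun_prop)
  have h0 : ∀ t : ℝ, circleMap 0 s (2 * Real.pi * t) ^ 2 ≠ 0 := fun t =>
    pow_ne_zero 2 (circleMap_ne_center hs.ne')
  simp only [deriv_circleMap]
  fun_prop (disch := assumption)

/-- The factor `a - b * (ζ ^ 2)⁻¹` is the derivative of `ζ ↦ a ζ + b ζ⁻¹`. The substitution makes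
the theory of circle integrals available on ellipses. -/
theorem integral_ellipticCurve (a b : ℂ) (s : ℝ) (hs : 0 < s) (hab : ‖b‖ ≠ ‖a‖ * s ^ 2)
    (f : ℂ → ℂ) :
    ∫ t in (0 : ℝ)..1, f ((ellipticCurve a b s hs hab).toFun t) *
        deriv (ellipticCurve a b s hs hab).toFun t =
      ∮ ζ in C(0, s), f (a * ζ + b * ζ⁻¹) * (a - b * (ζ ^ 2)⁻¹) := by
  have h := intervalIntegral.smul_integral_comp_mul_left (a := 0) (b := 1)
    (fun θ : ℝ => deriv (circleMap 0 s) θ • (f (a * circleMap 0 s θ + b * (circleMap 0 s θ)⁻¹) *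
      (a - b * ((circleMap 0 s θ) ^ 2)⁻¹))) (2 * Real.pi)
  rw [mul_zero, mul_one] at h
  rw [circleIntegral, ← h, ← intervalIntegral.integral_smul]
  refine intervalIntegral.integral_congr fun t _ => ?_
  rw [(hasDerivAt_ellipticCurve a b s hs hab t).deriv, real_smul, smul_eq_mul]
  push_cast
  change f (a * circleMap 0 s (2 * Real.pi * t) + b * (circleMap 0 s (2 * Real.pi * t))⁻¹) * _ = _
  ring

theorem norm_half_ne {s : ℝ} (hs : 0 < s) (hs1 : s < 1) :
    ‖(1 / 2 : ℂ)‖ ≠ ‖(1 / 2 : ℂ)‖ * s ^ 2 := by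
  have : s ^ 2 < 1 := by nlinarith
  have h2 : (0 : ℝ) < ‖(1 / 2 : ℂ)‖ := by norm_num
  exact (mul_lt_of_lt_one_right h2 this).ne'

/-- The image of the circle `|ζ| = s < 1` under the Joukowski map: an ellipse with foci `±1`,
traversed clockwise. -/
def bernsteinEllipse (s : ℝ) (hs : 0 < s) (hs1 : s < 1) : RectJordanCurve :=
  ellipticCurve (1 / 2) (1 / 2) s hs (norm_half_ne hs hs1)

/-- The circle about `0` of radius `ρ`, traversed counterclockwise. -/
def circleCurve (ρ : ℝ) (hρ : 0 < ρ) : RectJordanCurve :=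
  ellipticCurve 1 0 ρ hρ (by simpa using (pow_pos hρ 2).ne)

theorem joukowski_eq (ζ : ℂ) : joukowski ζ = 1 / 2 * ζ + 1 / 2 * ζ⁻¹ := by
  rw [joukowski]
  ring

theorem bernsteinEllipse_mem {R : ℝ} (hR : 1 < R) {s : ℝ} (hs : 0 < s) (hs1 : s < 1)
    (hsR : R⁻¹ < s) (t : ℝ) : (bernsteinEllipse s hs hs1).toFun t ∈ bernsteinInterior R := by
  have h : ‖circleMap 0 s (2 * Real.pi * t)‖ = s := by simp [abs_of_pos hs]
  have := joukowski_mem_bernsteinInterior (R := R) (by linarith) (hsR.trans_eq h.symm)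
    (h.trans_lt (hs1.trans hR))
  rwa [joukowski_eq] at this

theorem bernsteinEllipse_ne {s : ℝ} (hs : 0 < s) (hs1 : s < 1) (t : ℝ) {y : ℝ}
    (hy : y ∈ Icc (-1 : ℝ) 1) : (bernsteinEllipse s hs hs1).toFun t ≠ y := by
  intro h
  have hn : ‖circleMap 0 s (2 * Real.pi * t)‖ = s := by simp [abs_of_pos hs]
  have := norm_eq_one_of_joukowski_eq (circleMap_ne_center hs.ne') hy ((joukowski_eq _).trans h)
  linarith

theorem norm_circleCurve {ρ : ℝ} (hρ : 0 < ρ) (t : ℝ) : ‖(circleCurve ρ hρ).toFun t‖ = ρ := by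
  simp [circleCurve, ellipticCurve, abs_of_pos hρ]

theorem integral_circleCurve {ρ : ℝ} (hρ : 0 < ρ) (f : ℂ → ℂ) :
    ∫ t in (0 : ℝ)..1, f ((circleCurve ρ hρ).toFun t) * deriv (circleCurve ρ hρ).toFun t =
      ∮ ζ in C(0, ρ), f ζ := by
  rw [circleCurve, integral_ellipticCurve]
  simp

theorem integral_bernsteinEllipse {s : ℝ} (hs : 0 < s) (hs1 : s < 1) (f : ℂ → ℂ) :
    ∫ t in (0 : ℝ)..1, f ((bernsteinEllipse s hs hs1).toFun t) *
        deriv (bernsteinEllipse s hs hs1).toFun t =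
      ∮ ζ in C(0, s), f (joukowski ζ) * (1 / 2 - 1 / 2 * (ζ ^ 2)⁻¹) := by
  rw [bernsteinEllipse, integral_ellipticCurve]
  simp only [joukowski_eq]

/-! ### Cauchy's theorem and integral formula on ellipses -/

theorem differentiableAt_joukowski {ζ : ℂ} (hζ : ζ ≠ 0) : DifferentiableAt ℂ joukowski ζ := by
  unfold joukowski
  fun_prop (disch := assumption)

/-- The unit circle covers `[-1, 1]` twice, in opposite directions, so the two passes cancel
whatever `G` is. In the angle, `θ ↦ 2π - θ` fixes the cosine and negates the sine. -/
theorem joukowski_integral_unit_circle (G : ℂ → ℂ) :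
    ∮ ζ in C(0, 1), G (joukowski ζ) * (1 / 2 - 1 / 2 * (ζ ^ 2)⁻¹) = 0 := by
  have hJ : ∀ θ : ℝ, joukowski (circleMap 0 1 θ) = Complex.cos θ := by
    intro θ
    rw [joukowski, circleMap, Complex.cos, neg_mul, Complex.exp_neg]
    simp
  have hI : ∀ θ : ℝ, deriv (circleMap 0 1) θ •
      (G (joukowski (circleMap 0 1 θ)) * (1 / 2 - 1 / 2 * (circleMap 0 1 θ ^ 2)⁻¹)) =
      -(G (Complex.cos θ) * Complex.sin θ) := by
    intro θ
    rw [hJ, deriv_circleMap, circleMap, Complex.sin, neg_mul, Complex.exp_neg, smul_eq_mul]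
    have := Complex.exp_ne_zero (θ * I)
    simp only [ofReal_one, one_mul, zero_add]
    field_simp
    ring_nf
  simp only [circleIntegral, hI]
  have h := intervalIntegral.integral_comp_sub_left (a := 0) (b := 2 * Real.pi)
    (fun θ : ℝ => -(G (Complex.cos θ) * Complex.sin θ)) (2 * Real.pi)
  simp only [sub_self, sub_zero, ofReal_sub, ofReal_mul, ofReal_ofNat, Complex.cos_two_pi_sub,
    Complex.sin_two_pi_sub, mul_neg, neg_neg] at h
  rw [intervalIntegral.integral_neg] at h ⊢
  linear_combination (-1 / 2 : ℂ) * h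

/-- The pulled-back integrand is holomorphic on the annulus `s ≤ |ζ| ≤ 1`, so the circle can be
moved out to `|ζ| = 1`, where the integral cancels. -/
theorem bernsteinEllipse_integral_eq_zero {R : ℝ} (hR : 1 < R) {s : ℝ} (hs : 0 < s) (hs1 : s < 1)
    (hsR : R⁻¹ < s) {G : ℂ → ℂ} (hG : ∀ z ∈ bernsteinInterior R, DifferentiableAt ℂ G z) :
    ∫ t in (0 : ℝ)..1, G ((bernsteinEllipse s hs hs1).toFun t) *
        deriv (bernsteinEllipse s hs hs1).toFun t = 0 := by
  rw [integral_bernsteinEllipse]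
  have hd : ∀ ζ : ℂ, s ≤ ‖ζ‖ → ‖ζ‖ ≤ 1 →
      DifferentiableAt ℂ (fun ζ => G (joukowski ζ) * (1 / 2 - 1 / 2 * (ζ ^ 2)⁻¹)) ζ := by
    intro ζ h1 h2
    have h0 : ζ ≠ 0 := norm_pos_iff.1 (hs.trans_le h1)
    have hJ := hG _ (joukowski_mem_bernsteinInterior (zero_lt_one.trans hR) (hsR.trans_le h1)
      (h2.trans_lt hR))
    have := hJ.comp ζ (differentiableAt_joukowski h0)
    have h3 : ζ ^ 2 ≠ 0 := pow_ne_zero 2 h0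
    exact DifferentiableAt.mul this (by fun_prop (disch := assumption))
  refine (circleIntegral_eq_of_differentiable_on_annulus_off_countable (c := 0)
    (f := fun ζ => G (joukowski ζ) * (1 / 2 - 1 / 2 * (ζ ^ 2)⁻¹)) hs hs1.le
    countable_empty ?_ ?_).symm.trans (joukowski_integral_unit_circle G)
  · intro ζ hζ
    simp only [Set.mem_sdiff, mem_closedBall, mem_ball, dist_zero_right, not_lt] at hζ
    exact (hd ζ hζ.2 hζ.1).continuousAt.continuousWithinAt
  · intro ζ hζ
    simp only [Set.mem_sdiff, mem_closedBall, mem_ball, dist_zero_right, not_le] at hζ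
    exact hd ζ hζ.1.2.le hζ.1.1.le

theorem bernsteinEllipse_integral_inv_sub {s : ℝ} (hs : 0 < s) (hs1 : s < 1) {y : ℝ}
    (hy : y ∈ Icc (-1 : ℝ) 1) :
    ∫ t in (0 : ℝ)..1, ((bernsteinEllipse s hs hs1).toFun t - y)⁻¹ *
        deriv (bernsteinEllipse s hs hs1).toFun t = -(2 * Real.pi * I) := by
  obtain ⟨η, hη, hJ⟩ := exists_norm_eq_one_joukowski_eq hy
  have hη0 : η ≠ 0 := norm_ne_zero_iff.1 (by simp [hη])
  rw [integral_bernsteinEllipse hs hs1 fun ξ => (ξ - y)⁻¹]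
  have hout : ∀ w : ℂ, ‖w‖ = 1 → ∀ ζ ∈ closedBall (0 : ℂ) s, ζ - w ≠ 0 := by
    intro w hw ζ hζ h
    rw [sub_eq_zero.1 h, mem_closedBall, dist_zero_right, hw] at hζ
    linarith
  have hzero : ∀ w : ℂ, ‖w‖ = 1 → DiffContOnCl ℂ (fun ζ => (ζ - w)⁻¹) (ball 0 s) := by
    intro w hw
    refine (DifferentiableOn.diffContOnCl fun ζ hζ => ?_)
    rw [closure_ball _ hs.ne'] at hζ
    have h : DifferentiableAt ℂ (fun x : ℂ => x - w) ζ := by fun_prop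
    exact (h.inv (hout w hw ζ hζ)).differentiableWithinAt
  have hη' : ‖η⁻¹‖ = 1 := by simp [hη]
  have hci : ∀ w : ℂ, ‖w‖ = 1 → CircleIntegrable (fun ζ => (ζ - w)⁻¹) 0 s := fun w hw =>
    ContinuousOn.circleIntegrable hs.le (ContinuousOn.inv₀ (by fun_prop)
      fun ζ hζ => hout w hw ζ (sphere_subset_closedBall hζ))
  have hci0 : CircleIntegrable (fun ζ : ℂ => (ζ - 0)⁻¹) 0 s :=
    ContinuousOn.circleIntegrable hs.le (ContinuousOn.inv₀ (by fun_prop)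
      fun ζ hζ => by simpa using ne_of_mem_sphere hζ hs.ne')
  -- Partial fractions: the logarithmic derivative of `joukowski ζ - y = (ζ - η)(ζ - η⁻¹) / (2ζ)`.
  -- Since `|η| = 1 > s`, only the pole at `0` is enclosed, and its coefficient is `-1`.
  have hcongr : EqOn (fun ζ => (joukowski ζ - y)⁻¹ * (1 / 2 - 1 / 2 * (ζ ^ 2)⁻¹))
      (fun ζ => (ζ - η)⁻¹ + (ζ - η⁻¹)⁻¹ - (ζ - 0)⁻¹) (sphere 0 s) := by
    intro ζ hζ
    have h0 : ζ ≠ 0 := ne_of_mem_sphere hζ hs.ne'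
    have h1 := hout η hη ζ (sphere_subset_closedBall hζ)
    have h2 := hout _ hη' ζ (sphere_subset_closedBall hζ)
    have h3 : ζ * η - 1 ≠ 0 := by
      intro h
      apply h2
      field_simp
      rw [h, mul_zero]
    have hsub : joukowski ζ - y = (ζ - η) * (ζ * η - 1) / (2 * ζ * η) := by
      rw [← hJ]
      unfold joukowski
      field_simp
      ring
    have h4 : ζ - η⁻¹ = (ζ * η - 1) / η := by field_simp
    simp only [hsub, h4, sub_zero]
    field_simp
    ring
  have hadd : CircleIntegrable (fun ζ => (ζ - η)⁻¹ + (ζ - η⁻¹)⁻¹) 0 s := (hci η hη).add (hci _ hη')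
  rw [circleIntegral.integral_congr hs.le hcongr, circleIntegral.integral_sub hadd hci0,
    circleIntegral.integral_add (hci η hη) (hci _ hη'),
    circleIntegral.integral_sub_center_inv 0 hs.ne',
    (hzero η hη).circleIntegral_eq_zero hs.le, (hzero _ hη').circleIntegral_eq_zero hs.le]
  ring

/-- The singularity of the difference quotient at `a` is removable: its power series is that of `f`
shifted by one. -/
theorem differentiableAt_dslope {f : ℂ → ℂ} {a z : ℂ} (ha : AnalyticAt ℂ f a)
    (hz : DifferentiableAt ℂ f z) : DifferentiableAt ℂ (dslope f a) z := by
  rcases eq_or_ne z a with rfl | h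
  · obtain ⟨p, hp⟩ := ha
    exact hp.has_fpower_series_dslope_fslope.analyticAt.differentiableAt
  · exact (differentiableAt_dslope_of_ne h).2 hz

/-- **Cauchy's integral formula** on an ellipse with foci `±1`, traversed clockwise. -/
theorem bernsteinEllipse_integral_mul_inv_sub {R : ℝ} (hR : 1 < R) {s : ℝ} (hs : 0 < s)
    (hs1 : s < 1) (hsR : R⁻¹ < s) {f : ℂ → ℂ} (hf : ∀ z ∈ bernsteinInterior R, AnalyticAt ℂ f z)
    {y : ℝ} (hy : y ∈ Icc (-1 : ℝ) 1) :
    ∫ t in (0 : ℝ)..1, f ((bernsteinEllipse s hs hs1).toFun t) *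
        ((bernsteinEllipse s hs hs1).toFun t - y)⁻¹ * deriv (bernsteinEllipse s hs hs1).toFun t =
      -(2 * Real.pi * I) * f y := by
  set γ := (bernsteinEllipse s hs hs1).toFun with hγ
  have hd : ∀ z ∈ bernsteinInterior R, DifferentiableAt ℂ (dslope f y) z := fun z hz =>
    differentiableAt_dslope (hf _ (ofReal_mem_bernsteinInterior hR hy)) (hf z hz).differentiableAt
  have h1 := bernsteinEllipse_integral_eq_zero hR hs hs1 hsR hd
  have h2 := bernsteinEllipse_integral_inv_sub hs hs1 hy
  have hmem := bernsteinEllipse_mem hR hs hs1 hsR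
  have hne : ∀ t, γ t - y ≠ 0 := fun t => sub_ne_zero.2 (bernsteinEllipse_ne hs hs1 t hy)
  have hc : Continuous γ := continuous_ellipticCurve ..
  have hc' : Continuous (deriv γ) := continuous_deriv_ellipticCurve ..
  -- Subtracting `f y` leaves the difference quotient, to which Cauchy's theorem applies; the rest
  -- is the winding number about `y`.
  have hsplit : ∀ t, f (γ t) * (γ t - y)⁻¹ * deriv γ t =
      dslope f y (γ t) * deriv γ t + f y * ((γ t - y)⁻¹ * deriv γ t) := by
    intro t
    have := hne t
    rw [dslope_of_ne _ (sub_ne_zero.1 this), slope_def_field]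
    field_simp
    ring
  have hdc : Continuous fun t => dslope f y (γ t) := continuous_iff_continuousAt.2 fun t =>
    (hd _ (hmem t)).continuousAt.comp hc.continuousAt
  have hic : Continuous fun t => (γ t - y)⁻¹ := (hc.sub continuous_const).inv₀ hne
  have hi1 : Continuous fun t => dslope f y (γ t) * deriv γ t := hdc.mul hc'
  have hi2 : Continuous fun t => f y * ((γ t - y)⁻¹ * deriv γ t) :=
    continuous_const.mul (hic.mul hc')
  simp only [hsplit]
  rw [intervalIntegral.integral_add (hi1.intervalIntegrable _ _) (hi2.intervalIntegrable _ _), h1,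
    intervalIntegral.integral_const_mul, h2]
  ring

/-! ### The segment in the sphere -/

theorem coe_mem_segmentSphere {w : ℂ} :
    (w : OnePoint ℂ) ∈ segmentSphere ↔ ∃ y ∈ Icc (-1 : ℝ) 1, w = (y : ℂ) := by
  constructor
  · rintro ⟨y, hy⟩
    exact ⟨y, y.2, (OnePoint.coe_injective hy).symm⟩
  · rintro ⟨y, hy, rfl⟩
    exact ⟨⟨y, hy⟩, rfl⟩

theorem isClosed_segmentSphere : IsClosed segmentSphere := by
  have h : Continuous fun y : Icc (-1 : ℝ) 1 => (((y : ℝ) : ℂ) : OnePoint ℂ) :=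
    OnePoint.continuous_coe.comp (continuous_ofReal.comp continuous_subtype_val)
  exact (isCompact_range h).isClosed

theorem coe_notMem_segmentSphere_of_one_lt_norm {w : ℂ} (hw : 1 < ‖w‖) :
    (w : OnePoint ℂ) ∉ segmentSphere := by
  rw [coe_mem_segmentSphere]
  rintro ⟨y, hy, rfl⟩
  rw [norm_real] at hw
  exact absurd (abs_le.2 hy) (not_le.2 hw)

/-! ### Analyticity and decay of Cauchy transforms -/

section CauchyTransform

variable {μ : Measure (Icc (-1 : ℝ) 1)} {g : Icc (-1 : ℝ) 1 → ℂ}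

theorem norm_inv_sub_le {w : ℂ} {δ : ℝ} (hδ : 0 < δ)
    (hw : ∀ y : Icc (-1 : ℝ) 1, δ ≤ ‖((y : ℝ) : ℂ) - w‖) (y : Icc (-1 : ℝ) 1) :
    ‖(((y : ℝ) : ℂ) - w)⁻¹‖ ≤ δ⁻¹ := by
  rw [norm_inv]
  exact inv_anti₀ hδ (hw y)

theorem measurable_inv_sub (w : ℂ) :
    Measurable fun y : Icc (-1 : ℝ) 1 => (((y : ℝ) : ℂ) - w)⁻¹ := by
  have : Measurable fun y : Icc (-1 : ℝ) 1 => ((y : ℝ) : ℂ) :=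
    measurable_ofReal.comp measurable_subtype_coe
  exact (this.sub_const w).inv

theorem exists_dist_segment_pos {w : ℂ} (hw : (w : OnePoint ℂ) ∉ segmentSphere) :
    ∃ δ > 0, ∀ y : Icc (-1 : ℝ) 1, δ ≤ ‖((y : ℝ) : ℂ) - w‖ := by
  have hc : Continuous fun y : Icc (-1 : ℝ) 1 => ‖((y : ℝ) : ℂ) - w‖ := by fun_prop
  obtain ⟨y₀, -, hy₀⟩ := isCompact_univ.exists_isMinOn
    ⟨(⟨0, by norm_num⟩ : Icc (-1 : ℝ) 1), mem_univ _⟩ hc.continuousOn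
  refine ⟨_, norm_pos_iff.2 (sub_ne_zero.2 fun h => hw ⟨y₀, ?_⟩), fun y => hy₀ (mem_univ y)⟩
  rw [← h]

theorem differentiableAt_cauchyTransform (hg : Integrable g μ) {w : ℂ}
    (hw : (w : OnePoint ℂ) ∉ segmentSphere) :
    DifferentiableAt ℂ (fun z : ℂ => cauchyTransform μ g z) w := by
  obtain ⟨δ, hδ, hδw⟩ := exists_dist_segment_pos hw
  -- Within `δ / 2` of `w` the distance to the segment stays at least `δ / 2`, which gives a uniform
  -- integrable bound for differentiating under the integral.
  have hδ2 : 0 < δ / 2 := half_pos hδ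
  have hball : ∀ z ∈ ball w (δ / 2), ∀ y : Icc (-1 : ℝ) 1, δ / 2 ≤ ‖((y : ℝ) : ℂ) - z‖ := by
    intro z hz y
    have h1 := norm_sub_norm_le (((y : ℝ) : ℂ) - w) (z - w)
    rw [sub_sub_sub_cancel_right] at h1
    rw [mem_ball, dist_eq_norm] at hz
    linarith [hδw y]
  have hmeas : ∀ z, AEStronglyMeasurable (fun y => g y / (((y : ℝ) : ℂ) - z)) μ := fun z => by
    simp only [div_eq_mul_inv]
    exact hg.1.mul (measurable_inv_sub z).aestronglyMeasurable
  have hint : Integrable (fun y => g y / (((y : ℝ) : ℂ) - w)) μ := by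
    simp only [div_eq_mul_inv]
    exact hg.mul_bdd (c := δ⁻¹) (measurable_inv_sub w).aestronglyMeasurable
      (Eventually.of_forall (norm_inv_sub_le hδ hδw))
  have h := hasDerivAt_integral_of_dominated_loc_of_deriv_le (𝕜 := ℂ) (μ := μ)
    (F := fun z y => g y / (((y : ℝ) : ℂ) - z))
    (F' := fun z y => g y * ((((y : ℝ) : ℂ) - z)⁻¹ * (((y : ℝ) : ℂ) - z)⁻¹))
    (bound := fun y => ‖g y‖ * ((δ / 2)⁻¹ * (δ / 2)⁻¹)) (x₀ := w) (ball_mem_nhds w hδ2)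
    (Eventually.of_forall hmeas) hint
    (hg.1.mul ((measurable_inv_sub w).mul (measurable_inv_sub w)).aestronglyMeasurable)
    (Eventually.of_forall fun y z hz => by
      rw [norm_mul, norm_mul]
      have := norm_inv_sub_le hδ2 (hball z hz) y
      gcongr)
    (hg.norm.mul_const _)
    (Eventually.of_forall fun y z hz => by
      have hne : ((y : ℝ) : ℂ) - z ≠ 0 := norm_pos_iff.1 (hδ2.trans_le (hball z hz y))
      have := ((hasDerivAt_id z).const_sub ((y : ℝ) : ℂ)).inv hne
      refine (this.const_mul (g y)).congr_deriv ?_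
      simp only [id]
      field_simp)
  exact h.2.differentiableAt

theorem norm_mul_cauchyTransform_le (hg : Integrable g μ) {w : ℂ} (hw : 2 ≤ ‖w‖) :
    ‖w * cauchyTransform μ g w‖ ≤ 2 * ∫ y, ‖g y‖ ∂μ := by
  change ‖w * ∫ y, g y / (((y : ℝ) : ℂ) - w) ∂μ‖ ≤ _
  rw [← integral_const_mul, ← integral_const_mul]
  refine norm_integral_le_of_norm_le (hg.norm.const_mul 2) (Eventually.of_forall fun y => ?_)
  have h1 : ‖w‖ / 2 ≤ ‖((y : ℝ) : ℂ) - w‖ := by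
    have h2 := norm_sub_norm_le w ((y : ℝ) : ℂ)
    have h3 : ‖((y : ℝ) : ℂ)‖ ≤ 1 := by
      rw [norm_real]
      exact abs_le.2 y.2
    rw [norm_sub_rev] at h2
    linarith
  rw [norm_mul, norm_div, ← mul_div_assoc, div_le_iff₀ (by linarith)]
  nlinarith [norm_nonneg (g y)]

/-- The Cauchy transform divided by the Chebyshev polynomial of degree `n`, with value `0`
at `∞`. -/
def chebyshevCauchy (μ : Measure (Icc (-1 : ℝ) 1)) (n : ℕ) (g : Icc (-1 : ℝ) 1 → ℂ)
    (z : OnePoint ℂ) : ℂ :=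
  z.elim 0 fun w => cauchyTransform μ g w / (Chebyshev.T ℂ n).eval w

/-- The Cauchy transform is `O(1/w)` and `1 / T_n` tends to `0` since `n ≥ 1`. This extra decay is
what makes large circles contribute nothing. -/
theorem tendsto_mul_chebyshevCauchy (hg : Integrable g μ) {n : ℕ} (hn : n ≠ 0) :
    Tendsto (fun w : ℂ => w * chebyshevCauchy μ n g w) (cobounded ℂ) (𝓝 0) := by
  have hq : Tendsto (fun w : ℂ => ((Chebyshev.T ℂ n).eval w)⁻¹) (cobounded ℂ) (𝓝 0) := by
    refine tendsto_inv₀_cobounded.comp (tendsto_norm_atTop_iff_cobounded.1 ?_)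
    refine Polynomial.tendsto_norm_atTop _ ?_ tendsto_norm_cobounded_atTop
    rw [Chebyshev.degree_T]
    exact_mod_cast Nat.pos_of_ne_zero hn
  have hb : IsBoundedUnder (· ≤ ·) (cobounded ℂ)
      (norm ∘ fun w : ℂ => w * cauchyTransform μ g w) := by
    refine ⟨2 * ∫ y, ‖g y‖ ∂μ, ?_⟩
    rw [eventually_map]
    filter_upwards [tendsto_norm_cobounded_atTop.eventually (eventually_ge_atTop (2 : ℝ))] with w hw
    exact norm_mul_cauchyTransform_le hg hw
  refine (isBoundedUnder_le_mul_tendsto_zero hb hq).congr fun w => ?_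
  change _ = w * (cauchyTransform μ g w / (Chebyshev.T ℂ n).eval w)
  rw [div_eq_mul_inv, mul_assoc]

theorem differentiableAt_chebyshevCauchy (hg : Integrable g μ) {n : ℕ} (hn : n ≠ 0) {w : ℂ}
    (hw : (w : OnePoint ℂ) ∉ segmentSphere) :
    DifferentiableAt ℂ (fun z : ℂ => chebyshevCauchy μ n g z) w := by
  refine (differentiableAt_cauchyTransform hg hw).div (Polynomial.differentiable _ w)
    (eval_chebyshevT_ne_zero hn fun y hy h => hw (coe_mem_segmentSphere.2 ⟨y, hy, h⟩))

/-- At `∞` this is the removable singularity theorem for `w ↦ h(w⁻¹)`, which is differentiable near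
but off `0` and continuous at `0` by `hinf`. -/
theorem analyticOnSphere_of_differentiableAt {h : OnePoint ℂ → ℂ} {V : Set (OnePoint ℂ)}
    (hV : IsOpen V) (hd : ∀ z : ℂ, (z : OnePoint ℂ) ∈ V → DifferentiableAt ℂ (fun w : ℂ => h w) z)
    (hinf : Tendsto (fun w : ℂ => h w) (cobounded ℂ) (𝓝 (h OnePoint.infty))) :
    AnalyticOnSphere h V := by
  refine ⟨fun z hz => ?_, fun hV' => ?_⟩
  · have ho : IsOpen ((↑) ⁻¹' V : Set ℂ) := hV.preimage OnePoint.continuous_coe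
    exact DifferentiableOn.analyticAt (s := ((↑) : ℂ → OnePoint ℂ) ⁻¹' V)
      (fun w hw => (hd w hw).differentiableWithinAt) (ho.mem_nhds hz)
  · have heq : ∀ w : ℂ, w ≠ 0 → h (invChart w) = h ((w⁻¹ : ℂ) : OnePoint ℂ) := fun w hw => by
      rw [invChart, if_neg hw]
    have htop : ∀ᶠ w : ℂ in cobounded ℂ, (w : OnePoint ℂ) ∈ V := by
      have h1 : Tendsto ((↑) : ℂ → OnePoint ℂ) (cobounded ℂ) (𝓝 OnePoint.infty) := by
        rw [Metric.cobounded_eq_cocompact, ← coclosedCompact_eq_cocompact]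
        exact OnePoint.tendsto_coe_infty
      exact h1.eventually (hV.mem_nhds hV')
    refine analyticAt_of_differentiable_on_punctured_nhds_of_continuousAt ?_ ?_
    · filter_upwards [tendsto_inv₀_nhdsNE_zero.eventually htop, self_mem_nhdsWithin] with w hw hw0
      have h1 : DifferentiableAt ℂ (fun w : ℂ => h ((w⁻¹ : ℂ) : OnePoint ℂ)) w :=
        (hd _ hw).comp w (differentiableAt_inv hw0)
      refine h1.congr_of_eventuallyEq ?_
      filter_upwards [isOpen_ne.mem_nhds hw0] with v hv using heq v hv
    · rw [continuousAt_iff_punctured_nhds]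
      simp only [invChart, if_true]
      refine (hinf.comp tendsto_inv₀_nhdsNE_zero).congr' ?_
      filter_upwards [self_mem_nhdsWithin] with w hw
      exact (heq w hw).symm

theorem analyticOnSphere_chebyshevCauchy (hg : Integrable g μ) {n : ℕ} (hn : n ≠ 0) :
    AnalyticOnSphere (chebyshevCauchy μ n g) segmentSphereᶜ := by
  refine analyticOnSphere_of_differentiableAt isClosed_segmentSphere.isOpen_compl
    (fun z hz => differentiableAt_chebyshevCauchy hg hn hz) ?_
  have h := (tendsto_inv₀_cobounded (α := ℂ)).mul (tendsto_mul_chebyshevCauchy hg hn)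
  rw [zero_mul] at h
  refine h.congr' ?_
  filter_upwards [eventually_ne_cobounded (0 : ℂ)] with w hw
  rw [inv_mul_cancel_left₀ hw]

theorem AnalyticOnSphere.tendsto_cobounded {h : OnePoint ℂ → ℂ} {V : Set (OnePoint ℂ)}
    (hh : AnalyticOnSphere h V) (hV : OnePoint.infty ∈ V) :
    Tendsto (fun w : ℂ => h w) (cobounded ℂ) (𝓝 (h OnePoint.infty)) := by
  have h1 : Tendsto (fun w => h (invChart w)) (𝓝 0) (𝓝 (h (invChart 0))) :=
    (hh.2 hV).continuousAt
  have h2 := h1.comp (tendsto_inv₀_cobounded (α := ℂ))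
  simp only [invChart, if_true] at h2
  refine h2.congr' ?_
  filter_upwards [eventually_ne_cobounded (0 : ℂ)] with w hw
  simp [hw]

end CauchyTransform

/-- The integral does not depend on the radius, and is at most `2π` times the supremum of `|w Φ(w)|`
on the circle, which tends to `0`. -/
theorem circleIntegral_eq_zero_of_tendsto_cobounded {Φ : ℂ → ℂ} {ρ : ℝ} (hρ : 0 < ρ)
    (hd : ∀ z, ρ ≤ ‖z‖ → DifferentiableAt ℂ Φ z)
    (ht : Tendsto (fun w => w * Φ w) (cobounded ℂ) (𝓝 0)) : ∮ z in C(0, ρ), Φ z = 0 := by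
  have heq : ∀ ρ', ρ ≤ ρ' → ∮ z in C(0, ρ), Φ z = ∮ z in C(0, ρ'), Φ z := by
    intro ρ' h
    refine (circleIntegral_eq_of_differentiable_on_annulus_off_countable hρ h countable_empty
      ?_ ?_).symm
    · intro z hz
      simp only [Set.mem_sdiff, mem_closedBall, mem_ball, dist_zero_right, not_lt] at hz
      exact (hd z hz.2).continuousAt.continuousWithinAt
    · intro z hz
      simp only [Set.mem_sdiff, mem_closedBall, mem_ball, dist_zero_right, not_le] at hz
      exact hd z hz.1.2.le
  rw [← norm_le_zero_iff]
  refine le_of_forall_pos_le_add fun ε hε => ?_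
  have hε' : 0 < ε / (2 * Real.pi) := by positivity
  have hev := (ht.norm).eventually (gt_mem_nhds (by simpa using hε'))
  rw [← comap_norm_atTop, eventually_comap] at hev
  obtain ⟨ρ', hρ', h⟩ := (hev.and (eventually_ge_atTop ρ)).exists_forall_of_atTop.imp
    fun a ha => (⟨(ha a le_rfl).2, (ha a le_rfl).1⟩ : ρ ≤ a ∧ _)
  have hpos : 0 < ρ' := hρ.trans_le hρ'
  rw [heq ρ' hρ', zero_add]
  have := circleIntegral.norm_integral_le_of_norm_le_const (f := Φ) (c := 0)
    (C := ε / (2 * Real.pi) / ρ') hpos.le fun z hz => by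
      have hz' : ‖z‖ = ρ' := by simpa using hz
      have := (h z hz').le
      rw [norm_mul, hz'] at this
      rwa [le_div_iff₀ hpos, mul_comm]
  refine this.trans_eq ?_
  field_simp

/-! ### Contours separating a closed set from the segment -/

theorem circleCurve_integral_inv_sub {ρ : ℝ} (hρ : 0 < ρ) {w : ℂ} (hw : ‖w‖ < ρ) :
    ∫ t in (0 : ℝ)..1, ((circleCurve ρ hρ).toFun t - w)⁻¹ * deriv (circleCurve ρ hρ).toFun t =
      2 * Real.pi * I := by
  rw [integral_circleCurve hρ fun ξ => (ξ - w)⁻¹]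
  exact circleIntegral.integral_sub_inv_of_mem_ball (by simpa using hw)

theorem bernsteinEllipse_integral_inv_sub_of_notMem {R : ℝ} (hR : 1 < R) {s : ℝ} (hs : 0 < s)
    (hs1 : s < 1) (hsR : R⁻¹ < s) {w : ℂ} (hw : w ∉ bernsteinInterior R) :
    ∫ t in (0 : ℝ)..1, ((bernsteinEllipse s hs hs1).toFun t - w)⁻¹ *
        deriv (bernsteinEllipse s hs hs1).toFun t = 0 := by
  refine bernsteinEllipse_integral_eq_zero hR hs hs1 hsR (G := fun ξ => (ξ - w)⁻¹) fun z hz => ?_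
  have hne : z - w ≠ 0 := sub_ne_zero.2 fun h => hw (h ▸ hz)
  fun_prop (disch := assumption)

/-- The clockwise ellipse has index `0` on `F` and `-1` on the segment. This suffices when `∞ ∈ F`.
Otherwise `∞` must lie outside `U` with the same index `0` as the segment, so a counterclockwise
circle around `F` and the segment raises both indices by `1`. On that circle `k` is analytic up to
`∞`, hence bounded near it, and the decay of `h` removes the contribution. -/
theorem exists_separating_contour {R : ℝ} (hR : 1 < R) {F : Set (OnePoint ℂ)} (hF : IsClosed F)
    (hFR : ∀ z ∈ bernsteinInterior R, (z : OnePoint ℂ) ∉ F) {s : ℝ} (hs : 0 < s) (hs1 : s < 1)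
    (hsR : R⁻¹ < s) :
    ∃ (U : Set (OnePoint ℂ)) (Γ : Contour), IsOpen U ∧ F ⊆ U ∧ Disjoint U segmentSphere ∧
      (OnePoint.infty ∈ U → OnePoint.infty ∈ F) ∧ Γ.Separates F U ∧
      ∀ k h : OnePoint ℂ → ℂ, AnalyticOnSphere k Fᶜ →
        (∀ w : ℂ, (w : OnePoint ℂ) ∉ segmentSphere →
          DifferentiableAt ℂ (fun z : ℂ => h z) w) →
        Tendsto (fun w : ℂ => w * h w) (cobounded ℂ) (𝓝 0) →
        Γ.integral (fun ξ => k ξ * h ξ) =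
          ∫ t in (0 : ℝ)..1, k ((bernsteinEllipse s hs hs1).toFun t) *
            h ((bernsteinEllipse s hs hs1).toFun t) *
              deriv (bernsteinEllipse s hs hs1).toFun t := by
  have hpi : (2 * Real.pi * I : ℂ) ≠ 0 := two_pi_I_ne_zero
  have hFseg : F ⊆ segmentSphereᶜ := by
    rintro z hz ⟨y, rfl⟩
    exact hFR _ (ofReal_mem_bernsteinInterior hR y.2) hz
  have hell : ∀ t, (((bernsteinEllipse s hs hs1).toFun t : ℂ) : OnePoint ℂ) ∈
      segmentSphereᶜ \ F := by
    refine fun t => ⟨fun h => ?_, hFR _ (bernsteinEllipse_mem hR hs hs1 hsR t)⟩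
    obtain ⟨y, hy, h⟩ := coe_mem_segmentSphere.1 h
    exact bernsteinEllipse_ne hs hs1 t hy h
  have hFw : ∀ w : ℂ, (w : OnePoint ℂ) ∈ F → w ∉ bernsteinInterior R := fun w hw h => hFR w h hw
  by_cases hinf : OnePoint.infty ∈ F
  · refine ⟨segmentSphereᶜ, [bernsteinEllipse s hs hs1], isClosed_segmentSphere.isOpen_compl,
      hFseg, disjoint_compl_left, fun _ => hinf, ⟨?_, -1, ?_, ?_⟩, ?_⟩
    · rintro ξ ⟨γ, hγ, t, -, rfl⟩
      obtain rfl := List.mem_singleton.1 hγ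
      exact hell t
    · intro z hz
      induction z using OnePoint.rec with
      | infty => simp [Contour.index]
      | coe w =>
        simp [Contour.index, Contour.integral,
          bernsteinEllipse_integral_inv_sub_of_notMem hR hs hs1 hsR (hFw w hz)]
    · rintro z hz
      obtain ⟨y, rfl⟩ := not_not.1 hz
      simp only [Contour.index, Contour.integral, List.map_cons, List.map_nil, List.sum_cons,
        List.sum_nil, OnePoint.elim_some, bernsteinEllipse_integral_inv_sub hs hs1 y.2]
      push_cast
      field_simp
      simp
    · intro k h _ _ _
      simp [Contour.integral]
  · have hcpt := ((OnePoint.isClosed_iff_of_notMem hinf).1 hF).2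
    obtain ⟨ρ₀, hρ₀⟩ := hcpt.isBounded.exists_norm_le
    -- The circle has to enclose both `F`, bounded by `ρ₀`, and `[-1, 1]`, strictly.
    set ρ := max ρ₀ 1 + 1 with hρdef
    have hρ1 : 1 < ρ := by linarith [le_max_right ρ₀ 1]
    have hρ : 0 < ρ := by linarith
    have hFρ : ∀ w : ℂ, (w : OnePoint ℂ) ∈ F → ‖w‖ < ρ := fun w hw => by
      linarith [hρ₀ w hw, le_max_left ρ₀ 1]
    refine ⟨segmentSphereᶜ ∩ {OnePoint.infty}ᶜ, [bernsteinEllipse s hs hs1, circleCurve ρ hρ],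
      isClosed_segmentSphere.isOpen_compl.inter isOpen_compl_singleton,
      fun z hz => ⟨hFseg hz, fun h => hinf (h ▸ hz)⟩,
      disjoint_compl_left.mono_left inter_subset_left, fun h => absurd rfl h.2, ⟨?_, 0, ?_, ?_⟩, ?_⟩
    · rintro ξ ⟨γ, hγ, t, -, rfl⟩
      have hne : ∀ w : ℂ, (w : OnePoint ℂ) ∈ ({OnePoint.infty}ᶜ : Set (OnePoint ℂ)) :=
        fun w => OnePoint.coe_ne_infty w
      rcases List.mem_cons.1 hγ with rfl | hγ
      · exact ⟨⟨(hell t).1, hne _⟩, (hell t).2⟩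
      · obtain rfl := List.mem_singleton.1 hγ
        have hn := norm_circleCurve hρ t
        exact ⟨⟨coe_notMem_segmentSphere_of_one_lt_norm (hρ1.trans_eq hn.symm), hne _⟩,
          fun h => (hFρ _ h).ne hn⟩
    · intro z hz
      induction z using OnePoint.rec with
      | infty => exact absurd hz hinf
      | coe w =>
        simp only [Contour.index, Contour.integral, List.map_cons, List.map_nil, List.sum_cons,
          List.sum_nil, OnePoint.elim_some, circleCurve_integral_inv_sub hρ (hFρ w hz),
          bernsteinEllipse_integral_inv_sub_of_notMem hR hs hs1 hsR (hFw w hz)]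
        rw [zero_add, add_zero, inv_mul_cancel₀ hpi]
        simp
    · intro z hz
      induction z using OnePoint.rec with
      | infty => simp [Contour.index]
      | coe w =>
        have hw : (w : OnePoint ℂ) ∈ segmentSphere := by
          by_contra h
          exact hz ⟨h, OnePoint.coe_ne_infty w⟩
        obtain ⟨y, hy, rfl⟩ := coe_mem_segmentSphere.1 hw
        have hyn : ‖(y : ℂ)‖ < ρ := by
          rw [norm_real]
          exact (abs_le.2 hy).trans_lt hρ1
        simp only [Contour.index, Contour.integral, List.map_cons, List.map_nil, List.sum_cons,
          List.sum_nil, OnePoint.elim_some, circleCurve_integral_inv_sub hρ hyn,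
          bernsteinEllipse_integral_inv_sub hs hs1 hy]
        simp
    · intro k h hk hh ht
      have hzero : ∮ ξ in C(0, ρ), k ξ * h ξ = 0 := by
        refine circleIntegral_eq_zero_of_tendsto_cobounded hρ (fun z hz => ?_) ?_
        · exact (hk.1 z fun h => absurd (hFρ z h) (not_lt.2 hz)).differentiableAt.mul
            (hh z (coe_notMem_segmentSphere_of_one_lt_norm (hρ1.trans_le hz)))
        · have := (hk.tendsto_cobounded hinf).mul ht
          rw [mul_zero] at this
          exact this.congr fun w => by ring
      simp only [Contour.integral, List.map_cons, List.map_nil, List.sum_cons, List.sum_nil,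
        add_zero, integral_circleCurve hρ fun ξ : ℂ => k ξ * h ξ, hzero]

/-! ### The remainder of Chebyshev interpolation -/

/-- Hermite's remainder formula: multiply `inv_sub_sum_chebyshevBasis` by `f` and apply Cauchy's
formula at `y` and at every node. -/
theorem bernsteinEllipse_integral_chebyshev_remainder {R : ℝ} (hR : 1 < R) {s : ℝ} (hs : 0 < s)
    (hs1 : s < 1) (hsR : R⁻¹ < s) {f : ℂ → ℂ} (hf : ∀ z ∈ bernsteinInterior R, AnalyticAt ℂ f z)
    {n : ℕ} (hn : n ≠ 0) {y : ℝ} (hy : y ∈ Icc (-1 : ℝ) 1) :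
    ∫ t in (0 : ℝ)..1, f ((bernsteinEllipse s hs hs1).toFun t) *
        ((Chebyshev.T ℂ n).eval (y : ℂ) / ((Chebyshev.T ℂ n).eval
          ((bernsteinEllipse s hs hs1).toFun t) * ((bernsteinEllipse s hs hs1).toFun t - y))) *
        deriv (bernsteinEllipse s hs hs1).toFun t =
      -(2 * Real.pi * I) * (f y - ∑ j, f ((chebyshevNode n j : ℝ) : ℂ) *
        (chebyshevBasis n j).eval (y : ℂ)) := by
  have hcauchy := fun {y : ℝ} (hy : y ∈ Icc (-1 : ℝ) 1) =>
    bernsteinEllipse_integral_mul_inv_sub hR hs hs1 hsR hf hy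
  have hmem := bernsteinEllipse_mem hR hs hs1 hsR
  have hne := fun t {y : ℝ} (hy : y ∈ Icc (-1 : ℝ) 1) => bernsteinEllipse_ne hs hs1 t hy
  have hc : Continuous (bernsteinEllipse s hs hs1).toFun := continuous_ellipticCurve ..
  have hc' : Continuous (deriv (bernsteinEllipse s hs hs1).toFun) :=
    continuous_deriv_ellipticCurve ..
  set γ := (bernsteinEllipse s hs hs1).toFun
  have hcf : Continuous fun t => f (γ t) := continuous_iff_continuousAt.2 fun t =>
    (hf _ (hmem t)).continuousAt.comp hc.continuousAt
  have hci : ∀ {y : ℝ}, y ∈ Icc (-1 : ℝ) 1 →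
      Continuous fun t => f (γ t) * (γ t - y)⁻¹ * deriv γ t := fun hy =>
    (hcf.mul ((hc.sub continuous_const).inv₀ fun t => sub_ne_zero.2 (hne t hy))).mul hc'
  have hsplit : ∀ t, f (γ t) * ((Chebyshev.T ℂ n).eval (y : ℂ) / ((Chebyshev.T ℂ n).eval
      (γ t) * (γ t - y))) * deriv γ t = f (γ t) * (γ t - y)⁻¹ * deriv γ t -
        ∑ j, (chebyshevBasis n j).eval (y : ℂ) *
          (f (γ t) * (γ t - ((chebyshevNode n j : ℝ) : ℂ))⁻¹ * deriv γ t) := by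
    intro t
    rw [← inv_sub_sum_chebyshevBasis n (eval_chebyshevT_ne_zero hn fun y hy => hne t hy)
      (hne t hy), mul_sub, sub_mul, Finset.mul_sum, Finset.sum_mul]
    congr 1
    exact Finset.sum_congr rfl fun j _ => by ring
  have hcj : ∀ j, Continuous fun t => (chebyshevBasis n j).eval (y : ℂ) *
      (f (γ t) * (γ t - ((chebyshevNode n j : ℝ) : ℂ))⁻¹ * deriv γ t) := fun j =>
    continuous_const.mul (hci (chebyshevNode n j).2)
  simp only [hsplit]
  rw [intervalIntegral.integral_sub ((hci hy).intervalIntegrable _ _)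
    ((continuous_finsetSum _ fun j _ => hcj j).intervalIntegrable _ _),
    intervalIntegral.integral_finsetSum fun j _ => (hcj j).intervalIntegrable _ _, hcauchy hy]
  simp only [intervalIntegral.integral_const_mul, hcauchy (chebyshevNode n _).2]
  rw [mul_sub, Finset.mul_sum]
  congr 1
  exact Finset.sum_congr rfl fun j _ => by ring

/-- Fubini applied to the remainder formula. The sign is positive because the clockwise orientation
and the `y - z` in the Cauchy transform each contribute a minus. -/
theorem bernsteinEllipse_integral_chebyshevCauchy {μ : Measure (Icc (-1 : ℝ) 1)}
    [IsFiniteMeasure μ] {g : Icc (-1 : ℝ) 1 → ℂ} (hg : Integrable g μ)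
    {R : ℝ} (hR : 1 < R) {s : ℝ} (hs : 0 < s)
    (hs1 : s < 1) (hsR : R⁻¹ < s) {f : ℂ → ℂ} (hf : ∀ z ∈ bernsteinInterior R, AnalyticAt ℂ f z)
    {n : ℕ} (hn : n ≠ 0) :
    ∫ t in (0 : ℝ)..1, f ((bernsteinEllipse s hs hs1).toFun t) *
        chebyshevCauchy μ n (fun y => (Chebyshev.T ℂ n).eval ((y : ℝ) : ℂ) * g y)
          ((bernsteinEllipse s hs hs1).toFun t) * deriv (bernsteinEllipse s hs hs1).toFun t =
      (2 * Real.pi * I) * ∫ y : Icc (-1 : ℝ) 1, (f (y : ℝ) - ∑ j,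
        f ((chebyshevNode n j : ℝ) : ℂ) * (chebyshevBasis n j).eval ((y : ℝ) : ℂ)) * g y ∂μ := by
  have hrem := fun y : Icc (-1 : ℝ) 1 =>
    bernsteinEllipse_integral_chebyshev_remainder hR hs hs1 hsR hf hn y.2
  have hmem := bernsteinEllipse_mem hR hs hs1 hsR
  have hne := fun t {y : ℝ} (hy : y ∈ Icc (-1 : ℝ) 1) => bernsteinEllipse_ne hs hs1 t hy
  have hc : Continuous (bernsteinEllipse s hs hs1).toFun := continuous_ellipticCurve ..
  have hc' : Continuous (deriv (bernsteinEllipse s hs hs1).toFun) :=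
    continuous_deriv_ellipticCurve ..
  set γ := (bernsteinEllipse s hs hs1).toFun
  set q := Chebyshev.T ℂ n
  have hcf : Continuous fun t => f (γ t) := continuous_iff_continuousAt.2 fun t =>
    (hf _ (hmem t)).continuousAt.comp hc.continuousAt
  set A : ℝ → Icc (-1 : ℝ) 1 → ℂ := fun t y =>
    f (γ t) * (q.eval ((y : ℝ) : ℂ) / (q.eval (γ t) * (γ t - (y : ℝ)))) * deriv γ t with hA
  have hAc : Continuous fun p : ℝ × Icc (-1 : ℝ) 1 => A p.1 p.2 := by
    have h1 : Continuous fun p : ℝ × Icc (-1 : ℝ) 1 => ((p.2 : ℝ) : ℂ) := by fun_prop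
    have h2 : Continuous fun p : ℝ × Icc (-1 : ℝ) 1 => γ p.1 := hc.comp continuous_fst
    refine ((hcf.comp continuous_fst).mul ((q.continuous.comp h1).div
      ((q.continuous.comp h2).mul (h2.sub h1)) fun p => ?_)).mul (hc'.comp continuous_fst)
    exact mul_ne_zero (eval_chebyshevT_ne_zero hn fun y hy => hne p.1 hy)
      (sub_ne_zero.2 (hne p.1 p.2.2))
  -- `A` is continuous on the compact set `[0, 1] × [-1, 1]`, hence bounded there, while `g` is
  -- integrable.
  have hint : Integrable (Function.uncurry fun t y => A t y * g y)
      ((volume.restrict (Ioc (0 : ℝ) 1)).prod μ) := by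
    obtain ⟨c, hc⟩ := ((isCompact_Icc (a := (0 : ℝ)) (b := 1)).prod
      (isCompact_univ (X := Icc (-1 : ℝ) 1))).exists_bound_of_continuousOn hAc.continuousOn
    refine (hg.comp_snd _).bdd_mul (c := c) (f := fun p : ℝ × Icc (-1 : ℝ) 1 => A p.1 p.2)
      hAc.aestronglyMeasurable ?_
    have hprod : (volume.restrict (Ioc (0 : ℝ) 1)).prod μ =
        (volume.prod μ).restrict (Ioc (0 : ℝ) 1 ×ˢ univ) := by
      rw [← Measure.prod_restrict, Measure.restrict_univ]
    rw [hprod]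
    exact ae_restrict_of_forall_mem (measurableSet_Ioc.prod MeasurableSet.univ)
      fun p hp => hc p ⟨Ioc_subset_Icc_self hp.1, hp.2⟩
  have hleft : ∀ t, f (γ t) * chebyshevCauchy μ n (fun y => q.eval ((y : ℝ) : ℂ) * g y) (γ t) *
      deriv γ t = -∫ y, A t y * g y ∂μ := by
    intro t
    change f (γ t) * ((∫ y : Icc (-1 : ℝ) 1, q.eval ((y : ℝ) : ℂ) * g y /
      (((y : ℝ) : ℂ) - γ t) ∂μ) / q.eval (γ t)) * deriv γ t = _
    rw [div_eq_mul_inv, ← integral_mul_const, ← integral_const_mul, ← integral_mul_const,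
      ← integral_neg]
    refine integral_congr_ae (Eventually.of_forall fun y => ?_)
    have h1 : γ t - (y : ℝ) ≠ 0 := sub_ne_zero.2 (hne t y.2)
    have h2 : ((y : ℝ) : ℂ) - γ t ≠ 0 := sub_ne_zero.2 (hne t y.2).symm
    have h3 : q.eval (γ t) ≠ 0 := eval_chebyshevT_ne_zero hn fun y hy => hne t hy
    simp only [hA]
    rw [← neg_sub (γ t), div_neg]
    field_simp
  simp only [hleft]
  rw [intervalIntegral.integral_neg, intervalIntegral.integral_of_le zero_le_one,
    integral_integral_swap hint, ← integral_const_mul, ← integral_neg]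
  refine integral_congr_ae (Eventually.of_forall fun y => ?_)
  simp only
  rw [integral_mul_const, ← intervalIntegral.integral_of_le zero_le_one, hrem y]
  ring

/-! ### The interpolated kernel -/

section Interpolation

variable {D : Type*} [TopologicalSpace D] [CompactSpace D]

/-- The interpolation polynomial of a kernel in its second variable at the Chebyshev nodes. -/
def chebyshevKernel (n : ℕ) (K : C(D × Icc (-1 : ℝ) 1, ℂ)) : C(D × Icc (-1 : ℝ) 1, ℂ) where
  toFun p := ∑ j, K (p.1, chebyshevNode n j) * (chebyshevBasis n j).eval ((p.2 : ℝ) : ℂ)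
  continuous_toFun := by fun_prop

theorem integrable_coeFn_lp_two {E : Type*} [MeasurableSpace E] {μ : Measure E}
    [IsFiniteMeasure μ] (g : Lp ℂ 2 μ) : Integrable g μ :=
  (Lp.memLp g).integrable one_le_two

theorem integrable_continuous_mul {E : Type*} [TopologicalSpace E] [CompactSpace E]
    [SecondCountableTopology E] [MeasurableSpace E] [BorelSpace E] {μ : Measure E}
    {k g : E → ℂ} (hk : Continuous k) (hg : Integrable g μ) :
    Integrable (fun y => k y * g y) μ := by
  obtain ⟨c, hc⟩ := isCompact_univ.exists_bound_of_continuousOn hk.continuousOn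
  exact hg.bdd_mul hk.aestronglyMeasurable (Eventually.of_forall fun y => hc y (mem_univ y))

theorem kernelOpC_apply {E : Type*} [TopologicalSpace E] [CompactSpace E]
    [SecondCountableTopology E] [MeasurableSpace E] [BorelSpace E] (μ : Measure E)
    [IsFiniteMeasure μ] (K : C(D × E, ℂ)) (g : Lp ℂ 2 μ) (x : D) :
    kernelOpC μ K g x = ∫ y, K (x, y) * g y ∂μ := rfl

theorem kernelOpC_chebyshevKernel (μ : Measure (Icc (-1 : ℝ) 1)) [IsFiniteMeasure μ] (n : ℕ)
    (K : C(D × Icc (-1 : ℝ) 1, ℂ)) (g : Lp ℂ 2 μ) :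
    kernelOpC μ (chebyshevKernel n K) g =
      ∑ j, (∫ y : Icc (-1 : ℝ) 1, (chebyshevBasis n j).eval ((y : ℝ) : ℂ) * g y ∂μ) •
        K.comp ⟨fun x : D => (x, chebyshevNode n j), by fun_prop⟩ := by
  ext x
  have hint : ∀ j, Integrable (fun y : Icc (-1 : ℝ) 1 => K (x, chebyshevNode n j) *
      ((chebyshevBasis n j).eval ((y : ℝ) : ℂ) * g y)) μ := fun j =>
    (integrable_continuous_mul (by fun_prop) (integrable_coeFn_lp_two g)).const_mul _
  have heq : ∀ y, chebyshevKernel n K (x, y) * g y = ∑ j, K (x, chebyshevNode n j) *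
      ((chebyshevBasis n j).eval ((y : ℝ) : ℂ) * g y) := fun y => by
    change (∑ j, K (x, chebyshevNode n j) * (chebyshevBasis n j).eval ((y : ℝ) : ℂ)) * g y = _
    rw [Finset.sum_mul]
    exact Finset.sum_congr rfl fun j _ => mul_assoc ..
  rw [kernelOpC_apply]
  simp only [heq]
  rw [integral_finsetSum _ fun j _ => hint j, ContinuousMap.sum_apply]
  refine Finset.sum_congr rfl fun j _ => ?_
  rw [integral_const_mul, mul_comm]
  rfl

theorem rank_kernelOp_chebyshevKernel_le [SecondCountableTopology D] [MeasurableSpace D]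
    [BorelSpace D] (lam : Measure D) [IsFiniteMeasure lam] (μ : Measure (Icc (-1 : ℝ) 1))
    [IsFiniteMeasure μ] (n : ℕ) (K : C(D × Icc (-1 : ℝ) 1, ℂ)) :
    (kernelOp lam μ (chebyshevKernel n K)).toLinearMap.rank ≤ n := by
  set v : Fin n → Lp ℂ 2 lam := fun j =>
    ContinuousMap.toLp 2 lam ℂ (K.comp ⟨fun x : D => (x, chebyshevNode n j), by fun_prop⟩)
  have hle : (kernelOp lam μ (chebyshevKernel n K)).toLinearMap.range ≤
      Submodule.span ℂ (range v) := by
    rintro _ ⟨g, rfl⟩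
    change ContinuousMap.toLp 2 lam ℂ (kernelOpC μ (chebyshevKernel n K) g) ∈ _
    rw [kernelOpC_chebyshevKernel, map_sum]
    refine Submodule.sum_mem _ fun j _ => ?_
    rw [map_smul]
    exact Submodule.smul_mem _ _ (Submodule.subset_span (mem_range_self j))
  refine (Submodule.rank_mono hle).trans ((rank_span_le _).trans ?_)
  simpa using Cardinal.mk_range_le_lift (f := v)

end Interpolation

/-! ### The error bound -/

/-- `cauchyNorm` and `dualNorm` are infima over representing operators; a bound valid for each of
them passes to the infimum, so their uniqueness is never needed. -/
theorem le_mul_toReal_iInf_enorm {V : Type*} [SeminormedAddCommGroup V] {P : V → Prop} {a k : ℝ}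
    (hk : 0 ≤ k) (h : ∀ T, P T → a ≤ k * ‖T‖) (htop : (⨅ (T : V) (_ : P T), ‖T‖ₑ) ≠ ⊤) :
    a ≤ k * (⨅ (T : V) (_ : P T), ‖T‖ₑ).toReal := by
  rcases hk.eq_or_lt with rfl | hk
  · obtain ⟨T, hT⟩ := iInf_lt_iff.1 htop.lt_top
    obtain ⟨hP, -⟩ := iInf_lt_iff.1 hT
    simpa using h T hP
  · by_contra! hlt
    rw [← lt_div_iff₀' hk, ← ENNReal.lt_ofReal_iff_toReal_lt htop] at hlt
    obtain ⟨T, hT⟩ := iInf_lt_iff.1 hlt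
    obtain ⟨hP, hT⟩ := iInf_lt_iff.1 hT
    rw [ENNReal.lt_ofReal_iff_toReal_lt enorm_ne_top, toReal_enorm, lt_div_iff₀' hk] at hT
    exact absurd (h T hP) (not_le.2 hT)

/-- The reciprocal of the Chebyshev polynomial of degree `n`, with value `0` at `∞`. -/
def chebyshevInv (n : ℕ) (z : OnePoint ℂ) : ℂ :=
  z.elim 0 fun w => ((Chebyshev.T ℂ n).eval w)⁻¹

theorem measurable_chebyshevInv (n : ℕ) : Measurable (chebyshevInv n) := by
  have hemb : MeasurableEmbedding ((↑) : ℂ → OnePoint ℂ) :=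
    OnePoint.isOpenEmbedding_coe.measurableEmbedding
  have h := hemb.measurable_extend (g := fun w => ((Chebyshev.T ℂ n).eval w)⁻¹)
    (g' := fun _ => (0 : ℂ)) ((Chebyshev.T ℂ n).continuous.measurable.inv) measurable_const
  convert h using 1
  ext z
  induction z using OnePoint.rec with
  | infty =>
    rw [Function.extend_apply' _ _ _ fun ⟨w, hw⟩ => OnePoint.coe_ne_infty w hw]
    rfl
  | coe w =>
    rw [OnePoint.coe_injective.extend_apply]
    rfl

theorem chebyshevCauchy_eq_mul (μ : Measure (Icc (-1 : ℝ) 1)) (n : ℕ) (g : Icc (-1 : ℝ) 1 → ℂ)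
    (z : OnePoint ℂ) :
    chebyshevCauchy μ n g z = chebyshevInv n z * cauchyTransform μ g z := by
  induction z using OnePoint.rec with
  | infty => simp [chebyshevCauchy, chebyshevInv]
  | coe w => exact div_eq_inv_mul ..

theorem cauchyTransform_congr_ae {μ : Measure (Icc (-1 : ℝ) 1)} {g₁ g₂ : Icc (-1 : ℝ) 1 → ℂ}
    (h : g₁ =ᵐ[μ] g₂) : cauchyTransform μ g₁ = cauchyTransform μ g₂ := by
  ext z
  induction z using OnePoint.rec with
  | infty => rfl
  | coe w =>
    refine integral_congr_ae ?_
    filter_upwards [h] with y hy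
    rw [hy]

theorem norm_chebyshevInv_le {n : ℕ} (hn : n ≠ 0) {R : ℝ} (hR : 1 < R) {z : OnePoint ℂ}
    (hz : ∀ w : ℂ, z = w → w ∉ bernsteinInterior R) :
    ‖chebyshevInv n z‖ ≤ ((R ^ n - (R ^ n)⁻¹) / 2)⁻¹ := by
  have hpos := pow_sub_inv_pow_pos hR hn
  induction z using OnePoint.rec with
  | infty =>
    change ‖(0 : ℂ)‖ ≤ _
    rw [norm_zero]
    exact (inv_pos.2 hpos).le
  | coe w =>
    change ‖((Chebyshev.T ℂ n).eval w)⁻¹‖ ≤ _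
    rw [norm_inv]
    exact inv_anti₀ hpos (le_norm_eval_chebyshevT n hR (hz w rfl))

/-- The error operator is the composition of multiplication by `T_n`, the Cauchy transform `S`,
multiplication by `1 / T_n` on `F`, and `T`; the norms multiply. -/
theorem norm_kernelOp_sub_chebyshevKernel_le
    {D : Type*} [MetricSpace D] [CompactSpace D] [MeasurableSpace D] [BorelSpace D]
    (lam : Measure D) [IsFiniteMeasure lam]
    (μ : Measure (Icc (-1 : ℝ) 1)) [IsFiniteMeasure μ] {R : ℝ} (hR : 1 < R)
    {F : Set (OnePoint ℂ)} (hF : IsClosed F)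
    (hFR : ∀ z ∈ bernsteinInterior R, (z : OnePoint ℂ) ∉ F)
    (ν : Measure F) (K : C(D × Icc (-1 : ℝ) 1, ℂ)) (Kext : D → OnePoint ℂ → ℂ)
    (hext : ∀ (x : D) (y : Icc (-1 : ℝ) 1), Kext x (((y : ℝ) : ℂ) : OnePoint ℂ) = K (x, y))
    (hanal : ∀ x, AnalyticOnSphere (Kext x) Fᶜ) {n : ℕ} (hn : n ≠ 0)
    (p : ℝ≥0∞) [Fact (1 ≤ p)] {S : Lp ℂ 2 μ →L[ℂ] Lp ℂ p ν} (hS : IsCauchyOp μ p ν S)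
    {T : bergman p ν →L[ℂ] Lp ℂ 2 lam} (hT : IsDualOp Kext lam p ν T) :
    ‖kernelOp lam μ K - kernelOp lam μ (chebyshevKernel n K)‖ ≤
      ((R ^ n - (R ^ n)⁻¹) / 2)⁻¹ * ‖S‖ * ‖T‖ := by
  set c := ((R ^ n - (R ^ n)⁻¹) / 2)⁻¹ with hc
  have hc0 : 0 ≤ c := (inv_pos.2 (pow_sub_inv_pow_pos hR hn)).le
  refine ContinuousLinearMap.opNorm_le_bound _ (by positivity) fun g => ?_
  -- Any ellipse strictly inside the Bernstein ellipse will do: the estimate is made on `F`, so `s`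
  -- does not enter it.
  obtain ⟨s, hsR, hs1⟩ := exists_between (inv_lt_one_of_one_lt₀ hR)
  have hs : 0 < s := (inv_pos.2 (zero_lt_one.trans hR)).trans hsR
  set qg : Icc (-1 : ℝ) 1 → ℂ := fun y => (Chebyshev.T ℂ n).eval ((y : ℝ) : ℂ) * g y with hqg
  have hqgle : ∀ y, ‖qg y‖ ≤ ‖g y‖ := fun y => by
    rw [hqg, norm_mul]
    exact mul_le_of_le_one_left (norm_nonneg _) (norm_eval_chebyshevT_le_one n y)
  have hqc : Continuous fun y : Icc (-1 : ℝ) 1 => (Chebyshev.T ℂ n).eval ((y : ℝ) : ℂ) := by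
    fun_prop
  have hqgm : MemLp qg 2 μ := (Lp.memLp g).of_le
    (hqc.aestronglyMeasurable.mul (Lp.aestronglyMeasurable g)) (Eventually.of_forall hqgle)
  have hqgi : Integrable qg μ := hqgm.integrable one_le_two
  set G : Lp ℂ 2 μ := hqgm.toLp qg with hG
  have hGle : ‖G‖ ≤ ‖g‖ := by
    refine Lp.norm_le_norm_of_ae_le ?_
    filter_upwards [hqgm.coeFn_toLp] with y hy
    rw [hG, hy]
    exact hqgle y
  have hSG : S G =ᵐ[ν] fun z : F => cauchyTransform μ qg z := by
    have := hS G
    rwa [cauchyTransform_congr_ae hqgm.coeFn_toLp] at this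
  have hinv : ∀ z : F, ‖chebyshevInv n z‖ ≤ c := fun z =>
    norm_chebyshevInv_le hn hR fun w hw h => hFR w h (hw ▸ z.2)
  have hfle : ∀ z : F, ‖chebyshevInv n z * S G z‖ ≤ c * ‖S G z‖ := fun z => by
    rw [norm_mul]
    gcongr
    exact hinv z
  -- Membership in `L^p` comes from the boundedness of `1 / T_n` on `F`, so `ν` may be infinite.
  have hfm : MemLp (fun z : F => chebyshevInv n z * S G z) p ν := (Lp.memLp (S G)).of_le_mul
    (((measurable_chebyshevInv n).comp measurable_subtype_coe).aestronglyMeasurable.mul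
      (Lp.aestronglyMeasurable (S G))) (Eventually.of_forall hfle)
  set f : Lp ℂ p ν := hfm.toLp _ with hf
  have hfnorm : ‖f‖ ≤ c * ‖S G‖ := by
    refine Lp.norm_le_mul_norm_of_ae_le_mul ?_
    filter_upwards [hfm.coeFn_toLp] with z hz
    rw [hf, hz]
    exact hfle z
  have hfh : f =ᵐ[ν] fun z : F => chebyshevCauchy μ n qg z := by
    filter_upwards [hfm.coeFn_toLp, hSG] with z hz hz'
    rw [hf, hz, hz', chebyshevCauchy_eq_mul]
  obtain ⟨U, Γ, hU, hFU, hdisj, hinfU, hsep, hΓ⟩ :=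
    exists_separating_contour hR hF hFR hs hs1 hsR
  have han := analyticOnSphere_chebyshevCauchy hqgi hn
  have hUseg : U ⊆ segmentSphereᶜ := disjoint_left.1 hdisj
  have hrep : RepresentsOn F U (chebyshevCauchy μ n qg) :=
    ⟨hU, hFU, ⟨fun z hz => han.1 z (hUseg hz), fun hz => han.2 (hUseg hz)⟩, fun _ => rfl⟩
  -- No limit is involved: `f` is itself the class of a function in `H(F)`, so the contour formula
  -- for `T` applies to it directly.
  have hfb : f ∈ bergman p ν := Submodule.le_topologicalClosure _ ⟨U, _, hrep, hfh⟩
  have hTf := hT U _ Γ ⟨f, hfb⟩ hrep hdisj hinfU hsep hfh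
  have hval : ∀ x, (2 * Real.pi * I)⁻¹ * Γ.integral (fun ξ => Kext x ξ * chebyshevCauchy μ n qg ξ) =
      (kernelOpC μ K g - kernelOpC μ (chebyshevKernel n K) g) x := by
    intro x
    rw [hΓ _ _ (hanal x) (fun w hw => differentiableAt_chebyshevCauchy hqgi hn hw)
      (tendsto_mul_chebyshevCauchy hqgi hn),
      bernsteinEllipse_integral_chebyshevCauchy (integrable_coeFn_lp_two g) hR hs hs1 hsR
        (f := fun ξ => Kext x ξ) (fun z hz => (hanal x).1 z (hFR z hz)) hn,
      inv_mul_cancel_left₀ two_pi_I_ne_zero, ContinuousMap.sub_apply, kernelOpC_apply,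
      kernelOpC_apply, ← integral_sub
        (integrable_continuous_mul (k := fun y => K (x, y)) (by fun_prop)
          (integrable_coeFn_lp_two g))
        (integrable_continuous_mul (k := fun y => chebyshevKernel n K (x, y)) (by fun_prop)
          (integrable_coeFn_lp_two g))]
    refine integral_congr_ae (Eventually.of_forall fun y => ?_)
    simp only [hext]
    rw [sub_mul]
    rfl
  have hkey : (kernelOp lam μ K - kernelOp lam μ (chebyshevKernel n K)) g = T ⟨f, hfb⟩ := by
    have h1 : (kernelOp lam μ K - kernelOp lam μ (chebyshevKernel n K)) g =
        ContinuousMap.toLp 2 lam ℂ (kernelOpC μ K g - kernelOpC μ (chebyshevKernel n K) g) := by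
      rw [map_sub]
      rfl
    rw [h1]
    refine Lp.ext ?_
    filter_upwards [hTf, ContinuousMap.coeFn_toLp (p := 2) (𝕜 := ℂ) lam
      (kernelOpC μ K g - kernelOpC μ (chebyshevKernel n K) g)] with x hx hx'
    rw [hx, hx', hval]
  rw [hkey]
  calc ‖T ⟨f, hfb⟩‖ ≤ ‖T‖ * ‖f‖ := T.le_opNorm _
    _ ≤ ‖T‖ * (c * (‖S‖ * ‖g‖)) := by
      gcongr
      refine hfnorm.trans ?_
      gcongr
      exact (S.le_opNorm G).trans (by gcongr)
    _ = c * ‖S‖ * ‖T‖ * ‖g‖ := by ring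

end LowRank

end

/-! ### The main theorem -/

theorem mainTheorem4
    {D : Type*} [MetricSpace D] [CompactSpace D] [MeasurableSpace D] [BorelSpace D]
    (lam : Measure D) [IsFiniteMeasure lam]
    (μ : Measure (Icc (-1 : ℝ) 1)) [IsFiniteMeasure μ]
    (R : ℝ) (hR : 1 < R)
    (F : Set (OnePoint ℂ)) (hF : IsClosed F)
    (hFR : ∀ z ∈ LowRank.bernsteinInterior R, (z : OnePoint ℂ) ∉ F)
    (ν : Measure F)
    (K : C(D × Icc (-1 : ℝ) 1, ℂ)) (Kext : D → OnePoint ℂ → ℂ)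
    (hext : ∀ (x : D) (y : Icc (-1 : ℝ) 1), Kext x (((y : ℝ) : ℂ) : OnePoint ℂ) = K (x, y))
    (hcont : ContinuousOn (fun q : D × OnePoint ℂ => Kext q.1 q.2) (univ ×ˢ Fᶜ))
    (hanal : ∀ x, LowRank.AnalyticOnSphere (Kext x) Fᶜ)
    (n : ℕ) (hn : 1 ≤ n) :
    ∃ Kn : C(D × Icc (-1 : ℝ) 1, ℂ),
      (LowRank.kernelOp lam μ Kn).toLinearMap.rank ≤ n ∧
      ∀ (p : ℝ≥0∞) [Fact (1 ≤ p)],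
        LowRank.cauchyNorm μ p ν ≠ ⊤ → LowRank.dualNorm Kext lam p ν ≠ ⊤ →
        ‖LowRank.kernelOp lam μ K - LowRank.kernelOp lam μ Kn‖ ≤
          2 * R ^ (-(n : ℤ)) / (1 - R ^ (-(2 * n : ℤ))) *
            (LowRank.cauchyNorm μ p ν).toReal * (LowRank.dualNorm Kext lam p ν).toReal := by
  have hn0 : n ≠ 0 := Nat.one_le_iff_ne_zero.1 hn
  refine ⟨LowRank.chebyshevKernel n K, LowRank.rank_kernelOp_chebyshevKernel_le lam μ n K,
    fun p _ hC hK => ?_⟩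
  have hpos := LowRank.pow_sub_inv_pow_pos hR hn0
  -- The stated constant is `2 / (R^n - R^(-n))`, the reciprocal of the lower bound for `|T_n|` off
  -- the ellipse.
  have hconst : 2 * R ^ (-(n : ℤ)) / (1 - R ^ (-(2 * n : ℤ))) =
      ((R ^ n - (R ^ n)⁻¹) / 2)⁻¹ := by
    have hz : R ^ (-(2 * n : ℤ)) = (R ^ n)⁻¹ * (R ^ n)⁻¹ := by
      rw [two_mul, neg_add, zpow_add₀ (by linarith), zpow_neg, zpow_natCast]
    have hr : 1 < R ^ n := one_lt_pow₀ hR hn0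
    have h1 : R ^ n - (R ^ n)⁻¹ ≠ 0 := by linarith
    have h2 : 1 - (R ^ n)⁻¹ * (R ^ n)⁻¹ ≠ 0 := by
      have : (R ^ n)⁻¹ < 1 := inv_lt_one_of_one_lt₀ hr
      have h0 : 0 < (R ^ n)⁻¹ := by positivity
      nlinarith
    have h3 : R ^ n ≠ 0 := by positivity
    rw [hz, zpow_neg, zpow_natCast, inv_div, div_eq_div_iff h2 h1]
    field_simp
  rw [hconst]
  -- The two infima are removed one at a time, the other factors playing the role of the nonnegative
  -- constant.
  refine LowRank.le_mul_toReal_iInf_enorm (by positivity) (fun T hT => ?_) hK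
  rw [mul_right_comm]
  refine LowRank.le_mul_toReal_iInf_enorm (by positivity) (fun S hS => ?_) hC
  rw [mul_right_comm]
  exact LowRank.norm_kernelOp_sub_chebyshevKernel_le lam μ hR hF hFR ν K Kext hext hanal hn0 p
    hS hT
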